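/- Let $G=(V,E)$ be the complete graph on a finite vertex set $V$, let $c\colon E\to\mathbb{R}_{\ge 0}$ be edge costs satisfying the triangle inequality, and let $s\neq t$ be two vertices. For $S\subseteq V$ let $\delta(S)$ be the set of edges with exactly one end in $S$, write $\delta(v)=\delta(\{v\})$, and for $x\in\mathbb{R}^E$ and $D\subseteq E$ write $x(D)=\sum_{e\in D}x_e$; for $D\subseteq E$ write $c(D)=\sum_{e\in D}c_e$, and write $c(x)=\sum_{e\in E}c_ex_e$. The path version of the Held--Karp relaxation is the linear program $$\min c(x)\ \text{ subject to }\ x(\delta(s))=x(\delta(t))=1,\quad x(\delta(v))=2\ (v\ne s,t),$$ $$x(\delta(S))\ge 1\ \ (\emptyset\subsetneq S\subsetneq V,\ |S\cap\{s,t\}|=1),\qquad x(\delta(S))\ge 2\ \ (\emptyset\subsetneq S\subsetneq V,\ |S\cap\{s,t\}|\text{ even}),\qquad 0\le x_e\le 1\ (e\in E).$$ The randomized Christofides algorithm for the $s$-$t$ path TSP works as follows. 1. Compute an optimal solution $x^*$ of this linear program. 2. Write $x^*=\sum_{i=1}^{l}\lambda_i\chi^{J_i}$ with $\lambda_i>0$,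 $\sum_i\lambda_i=1$, where $\chi^{J_i}$ is the incidence vector of a spanning tree $J_i$ of $G$, and sample $J=J_i$ with probability $\lambda_i$. 3. Let $T$ be the set of wrong degree vertices of $J$, i.e. those of $s,t$ that have even degree in $J$ and those other vertices that have odd degree in $J$. Compute a minimum-cost $T$-join $F$, i.e. a minimum-cost set $F\subseteq E$ such that $T$ is the set of odd degree vertices of $(V,F)$. 4. Take an Eulerian traversal from $s$ to $t$ of the multigraph $J\,\dot\cup\,F$ (edges in both sets are kept twice), and shortcut it to a Hamiltonian $s$-$t$ path $H$, i.e. one that visits the vertices in an order in which they occur along the traversal. **Theorem.** The algorithm achieves an approximation factor of $8/5$. That is, every step can be carried out (the linear program has an optimal solution, every optimal solution has a decomposition as in step 2, and the joins, traversals and shortcuts of steps 3 and 4 exist, whatever choices were made before), and whatever optimal solution, decomposition, minimum-cost joins, traversals and shortcuts are chosen, $$\mathbb{E}[c(H)]\ \le\ \mathbb{E}[c(J)+c(F)]\ \le\ \tfrac85\,c(x^*)\qquad\text{and}\qquad c(x^*)\le c(H')\ \text{ for every Hamiltonian } s\text{-}t \text{ path } H';$$ in particular the expected cost of the computed path is at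 most $\tfrac85$ times the minimum cost of a Hamiltonian $s$-$t$ path. -/

import Mathlib

namespace STPathTSP

variable {V : Type*} [Fintype V] [DecidableEq V]

/-- The edge set of the complete graph on `V`. -/
def edges (V : Type*) [Fintype V] [DecidableEq V] : Finset (Sym2 V) :=
  (⊤ : SimpleGraph V).edgeFinset

/-- Nonnegative edge costs satisfying the triangle inequality.  Only the values of `c` on the
edges of the complete graph (not on the loops `s(v, v)`) are constrained or ever used. -/
structure IsMetricCost (c : Sym2 V → ℝ) : Prop where
  nonneg : ∀ e ∈ edges V, 0 ≤ c e
  triangle : ∀ u v w : V, u ≠ v → v ≠ w → u ≠ w → c s(u, w) ≤ c s(u, v) + c s(v, w)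

/-- `δ(S)`: the edges with exactly one end in `S`. -/
def cut (S : Finset V) : Finset (Sym2 V) :=
  Finset.univ.filter fun e => ∃ u v : V, u ∈ S ∧ v ∉ S ∧ e = s(u, v)

/-- The number of edges of `K` incident with `v`, i.e. `|δ(v) ∩ K|`. -/
def deg (K : Finset (Sym2 V)) (v : V) : ℕ := (cut {v} ∩ K).card

/-- Feasibility for the path version of the Held-Karp linear program. -/
structure IsFeasible (s t : V) (x : Sym2 V → ℝ) : Prop where
  deg_s : ∑ e ∈ cut {s}, x e = 1
  deg_t : ∑ e ∈ cut {t}, x e = 1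
  deg_other : ∀ v, v ≠ s → v ≠ t → ∑ e ∈ cut {v}, x e = 2
  odd_cut : ∀ S : Finset V, S.Nonempty → S ≠ Finset.univ → (S ∩ {s, t}).card = 1 →
    1 ≤ ∑ e ∈ cut S, x e
  even_cut : ∀ S : Finset V, S.Nonempty → S ≠ Finset.univ → Even (S ∩ {s, t}).card →
    2 ≤ ∑ e ∈ cut S, x e
  nonneg : ∀ e ∈ edges V, 0 ≤ x e
  le_one : ∀ e ∈ edges V, x e ≤ 1

/-- The objective value `∑ c_e x_e`. -/
def lpCost (c x : Sym2 V → ℝ) : ℝ := ∑ e ∈ edges V, c e * x e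

/-- `x` is an optimal solution of the path version of the Held-Karp linear program. -/
def IsOptimal (c : Sym2 V → ℝ) (s t : V) (x : Sym2 V → ℝ) : Prop :=
  IsFeasible s t x ∧ ∀ y, IsFeasible s t y → lpCost c x ≤ lpCost c y

/-- The edge set `J` is (the edge set of) a spanning tree of the complete graph on `V`. -/
def IsSpanningTree (J : Finset (Sym2 V)) : Prop :=
  J ⊆ edges V ∧ (SimpleGraph.fromEdgeSet (J : Set (Sym2 V))).IsTree

/-- `x = ∑ i, lam i • χ(J i)` is a convex combination, with positive coefficients, of incidence
vectors of spanning trees. -/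
structure IsTreeDecomposition (x : Sym2 V → ℝ) {l : ℕ} (lam : Fin l → ℝ)
    (J : Fin l → Finset (Sym2 V)) : Prop where
  pos : ∀ i, 0 < lam i
  sum_eq_one : ∑ i, lam i = 1
  tree : ∀ i, IsSpanningTree (J i)
  sum_eq : ∀ e ∈ edges V, ∑ i, lam i * (if e ∈ J i then 1 else 0) = x e

/-- The wrong degree vertices of `K`: `s` or `t` if of even degree, any other vertex if of odd
degree. -/
def wrongVertices (s t : V) (K : Finset (Sym2 V)) : Finset V :=
  Finset.univ.filter fun v => if v = s ∨ v = t then Even (deg K v) else Odd (deg K v)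

/-- `F` is a `T`-join: a set of edges whose set of odd degree vertices is `T`. -/
def IsTJoin (T : Finset V) (F : Finset (Sym2 V)) : Prop :=
  F ⊆ edges V ∧ ∀ v, Odd (deg F v) ↔ v ∈ T

/-- `F` is a `T`-join of minimum cost. -/
def IsMinTJoin (c : Sym2 V → ℝ) (T : Finset V) (F : Finset (Sym2 V)) : Prop :=
  IsTJoin T F ∧ ∀ F', IsTJoin T F' → ∑ e ∈ F, c e ≤ ∑ e ∈ F', c e

/-- `p` is an Eulerian traversal from `s` to `t` of the multigraph obtained as the disjoint union
of `J` and `F`: it uses each edge as often as it occurs in the union, with multiplicity. -/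
def IsEulerianTraversal {s t : V} (J F : Finset (Sym2 V))
    (p : (⊤ : SimpleGraph V).Walk s t) : Prop :=
  (p.edges : Multiset (Sym2 V)) = J.val + F.val

/-- The Hamiltonian `s`-`t` path `q` is obtained by shortcutting `p`: its vertices are visited in
an order in which they occur along `p`. -/
def IsShortcut {s t : V} (p q : (⊤ : SimpleGraph V).Walk s t) : Prop :=
  q.IsHamiltonian ∧ q.support.Sublist p.support

/-- The total cost of the edges of a walk. -/
def walkCost {s t : V} (c : Sym2 V → ℝ) (p : (⊤ : SimpleGraph V).Walk s t) : ℝ :=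
  (p.edges.map c).sum

/-- The expectation of `X i` when `i` is drawn with probability `lam i`. -/
def expect {l : ℕ} (lam X : Fin l → ℝ) : ℝ := ∑ i, lam i * X i

/-- One execution of the randomized Christofides algorithm, with every outcome of the random
sampling recorded: `x` is the optimal LP solution that is computed, the tree `J i` is sampled
with probability `lam i`, and if it is sampled then `F i` is the minimum-cost join that is added,
`p i` the Eulerian traversal of the union and `q i` the Hamiltonian path that is returned. -/
structure IsExecution (c : Sym2 V → ℝ) (s t : V) (x : Sym2 V → ℝ) {l : ℕ} (lam : Fin l → ℝ)
    (J F : Fin l → Finset (Sym2 V)) (p q : Fin l → (⊤ : SimpleGraph V).Walk s t) : Prop where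
  optimal : IsOptimal c s t x
  decomposition : IsTreeDecomposition x lam J
  join : ∀ i, IsMinTJoin c (wrongVertices s t (J i)) (F i)
  traversal : ∀ i, IsEulerianTraversal (J i) (F i) (p i)
  shortcut : ∀ i, IsShortcut (p i) (q i)

end STPathTSP

open STPathTSP

set_option linter.unusedSectionVars false

/-! Let `I` be the `s`-`t` path in the sampled tree `J`. The wrong degree vertices of `J` are the
odd degree vertices of `J \ I`, so by `join_cost_le` the join costs at most `c(y)` for every `y ≥ 0`
with `y(δ(S)) ≥ 1` on all cuts that `J \ I` meets in an odd number of edges. As `E[χ^J] = x`, the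
tree costs `c(x)` on average, and it remains to find such vectors `y` with `E[y] ≤ 3/5 x`.

Start with `2/5 x + 1/5 χ^J - 1/10 χ^I`. A relevant cut that does not separate `s` from `t` has
`x(δ(S)) ≥ 2` and an edge of `J \ I`, which already gives 1. A relevant cut that separates them is
crossed by `I` and by `J \ I`, hence at least twice by `J`. If `σ` is the probability that the tree
has a single edge in this cut, then `x(δ(S)) ≥ 2 - σ`, and at most `2σ/5 - 1/10` is missing. This is
supplied by `α` times `singleVector`, whose mass on the cut is `σ`, and it is added only for trees
without a single edge there, that is, with probability `1 - σ`.

A cut with a single tree edge is determined by that edge, and the edge lies on `I`. So the vectors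
`singleVector` of all separating sets add up to at most `E[χ^I]` (`sum_singleVector_le`), and the
saved `1/10 E[χ^I]` pays for the corrections if `(1 - σ)α ≤ 1/10`. Suitable `α` exist because `(2σ -
1)² ≥ 0` (`exists_coefficient`).

The join inequality rests on a packing of cuts: for integer weights that are even on every edge set
of zero boundary, some cut can be lowered by one so that the minimum weight of a join drops by at
most one (`exists_reducing_cut`). The tree decomposition comes from separating a point from the
convex hull of spanning trees and comparing it with a tree that maximizes the separating functional
(`mem_convexHull_spanningTrees`). -/

namespace STPathTSP

variable {V : Type*} [Fintype V] [DecidableEq V]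

/-! ### Boundaries and cuts modulo 2 -/

/-- The coboundary modulo 2 of a function on the vertices. -/
def coboundary (φ : V → ZMod 2) : Sym2 V → ZMod 2 :=
  Sym2.lift ⟨fun u v => φ u + φ v, fun u v => add_comm (φ u) (φ v)⟩

@[simp] theorem coboundary_mk (φ : V → ZMod 2) (u v : V) : coboundary φ s(u, v) = φ u + φ v := rfl

/-- The indicator function modulo 2 of a vertex set. -/
def indicator (S : Finset V) : V → ZMod 2 := fun v => if v ∈ S then 1 else 0

/-- The boundary modulo 2 of a multiset of edges. -/
def boundary (M : Multiset (Sym2 V)) : V → ZMod 2 :=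
  fun v => (M.map (coboundary (Pi.single v 1))).sum

theorem mem_cut {S : Finset V} {u v : V} :
    s(u, v) ∈ cut S ↔ (u ∈ S ∧ v ∉ S) ∨ (v ∈ S ∧ u ∉ S) := by
  simp only [cut, Finset.mem_filter, Finset.mem_univ, true_and]
  constructor
  · rintro ⟨a, b, ha, hb, h⟩
    rcases Sym2.eq_iff.1 h with ⟨rfl, rfl⟩ | ⟨rfl, rfl⟩ <;> tauto
  · rintro (⟨h, h'⟩ | ⟨h, h'⟩)
    · exact ⟨u, v, h, h', rfl⟩
    · exact ⟨v, u, h, h', Sym2.eq_swap⟩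

theorem cut_subset_edges (S : Finset V) : cut S ⊆ edges V := by
  intro e
  induction e with
  | _ u v =>
    rw [mem_cut]
    simp only [edges, SimpleGraph.mem_edgeFinset, SimpleGraph.mem_edgeSet, SimpleGraph.top_adj]
    rintro (h | h) rfl <;> tauto

theorem mem_edges {u v : V} : s(u, v) ∈ edges V ↔ u ≠ v := by
  simp [edges]

theorem cut_compl (S : Finset V) : cut Sᶜ = cut S := by
  ext e
  induction e with
  | _ u v => simp only [mem_cut, Finset.mem_compl]; tauto

theorem coboundary_indicator (S : Finset V) (e : Sym2 V) :
    coboundary (indicator S) e = if e ∈ cut S then 1 else 0 := by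
  induction e with
  | _ u v =>
    simp only [coboundary_mk, mem_cut, indicator]
    by_cases hu : u ∈ S <;> by_cases hv : v ∈ S <;> simp [hu, hv]; decide

theorem indicator_singleton (v : V) : indicator {v} = Pi.single v 1 := by
  ext u
  simp [indicator, Pi.single_apply]

theorem coboundary_eq_sum (φ : V → ZMod 2) (e : Sym2 V) :
    coboundary φ e = ∑ v, coboundary (Pi.single v 1) e * φ v := by
  induction e with
  | _ a b => simp [add_mul, Finset.sum_add_distrib, Pi.single_apply]

theorem sum_map_coboundary (M : Multiset (Sym2 V)) (φ : V → ZMod 2) :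
    (M.map (coboundary φ)).sum = ∑ v, boundary M v * φ v := by
  induction M using Multiset.induction_on with
  | empty => simp [boundary]
  | cons e M ih =>
    rw [Multiset.map_cons, Multiset.sum_cons, ih, coboundary_eq_sum φ e, ← Finset.sum_add_distrib]
    refine Finset.sum_congr rfl fun v _ => ?_
    rw [← add_mul, boundary, boundary, Multiset.map_cons, Multiset.sum_cons]

theorem boundary_add (M N : Multiset (Sym2 V)) : boundary (M + N) = boundary M + boundary N := by
  ext v; simp [boundary]

theorem boundary_zero : boundary (0 : Multiset (Sym2 V)) = 0 := by
  ext v; simp [boundary]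

theorem boundary_singleton (u v : V) :
    boundary {s(u, v)} = (Pi.single u 1 + Pi.single v 1 : V → ZMod 2) := by
  ext w; simp [boundary, Pi.single_apply, eq_comm]

theorem natCast_deg (F : Finset (Sym2 V)) (v : V) : (deg F v : ZMod 2) = boundary F.val v := by
  rw [boundary, ← indicator_singleton, deg, Finset.inter_comm, ← Finset.filter_mem_eq_inter,
    Finset.natCast_card_filter]
  exact Finset.sum_congr rfl fun e _ => (coboundary_indicator _ e).symm

theorem odd_deg_iff (F : Finset (Sym2 V)) (v : V) : Odd (deg F v) ↔ boundary F.val v = 1 := by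
  rw [← natCast_deg, ZMod.natCast_eq_one_iff_odd]

theorem even_deg_iff (F : Finset (Sym2 V)) (v : V) : Even (deg F v) ↔ boundary F.val v = 0 := by
  rw [← natCast_deg, ZMod.natCast_eq_zero_iff_even]

/-- The handshake argument for a vertex set: modulo 2, edges inside `S` are counted twice. All
parity arguments about cuts go through this. -/
theorem natCast_card_cut (F : Finset (Sym2 V)) (S : Finset V) :
    ((cut S ∩ F).card : ZMod 2) = ∑ v ∈ S, boundary F.val v := by
  rw [Finset.inter_comm, ← Finset.filter_mem_eq_inter, Finset.natCast_card_filter]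
  have := sum_map_coboundary F.val (indicator S)
  simp only [indicator, mul_ite, mul_one, mul_zero, Finset.sum_ite_mem, Finset.univ_inter] at this
  rw [← this]
  exact Finset.sum_congr rfl fun e _ => (coboundary_indicator _ e).symm

theorem sum_symmDiff_zmod_two {α : Type*} [DecidableEq α] (A B : Finset α) (f : α → ZMod 2) :
    ∑ e ∈ symmDiff A B, f e = ∑ e ∈ A, f e + ∑ e ∈ B, f e := by
  have h : ∀ C D : Finset α, ∑ e ∈ C \ D, f e = ∑ e ∈ C, f e - ∑ e ∈ C ∩ D, f e := fun C D => by
    rw [eq_sub_iff_add_eq, ← Finset.sum_inter_add_sum_sdiff C D, add_comm]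
  rw [symmDiff_def, Finset.sup_eq_union, Finset.sum_union disjoint_sdiff_sdiff, h, h,
    Finset.inter_comm B A]
  have : ∀ a b c : ZMod 2, a - c + (b - c) = a + b := by decide
  exact this _ _ _

theorem boundary_symmDiff (A B : Finset (Sym2 V)) :
    boundary (symmDiff A B).val = boundary A.val + boundary B.val := by
  ext v; exact sum_symmDiff_zmod_two A B _

theorem zmod_two_add_self (a : ZMod 2) : a + a = 0 := CharTwo.add_self_eq_zero a

theorem boundary_walk {G : SimpleGraph V} {u v : V} (p : G.Walk u v) :
    boundary (p.edges : Multiset (Sym2 V)) = (Pi.single u 1 + Pi.single v 1 : V → ZMod 2) := by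
  induction p with
  | nil => ext w; simp [boundary_zero, zmod_two_add_self]
  | @cons a b c h p ih =>
    rw [SimpleGraph.Walk.edges_cons, ← Multiset.cons_coe, ← Multiset.singleton_add, boundary_add,
      ih, boundary_singleton]
    ext w
    simp only [Pi.add_apply]
    have : ∀ a b c : ZMod 2, a + b + (b + c) = a + c := by decide
    exact this _ _ _

/-! ### Paths, components and connectedness -/

/-- The edges of a path between two vertices that are connected by edges in `H`. -/
theorem exists_path_of_reachable {H : Set (Sym2 V)} {u v : V}
    (h : (SimpleGraph.fromEdgeSet H).Reachable u v) :
    ∃ P : Finset (Sym2 V), (↑P ⊆ H) ∧ P ⊆ edges V ∧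
      boundary P.val = (Pi.single u 1 + Pi.single v 1 : V → ZMod 2) := by
  obtain ⟨p, hp⟩ := h.exists_isPath
  have hval : (p.edges.toFinset).val = (p.edges : Multiset (Sym2 V)) := by
    rw [List.toFinset_val, hp.isTrail.edges_nodup.dedup]
  have hmem : ∀ e ∈ p.edges.toFinset, e ∈ H ∧ e ∈ edges V := fun e he => by
    have := p.edges_subset_edgeSet (List.mem_toFinset.1 he)
    induction e with
    | _ a b =>
      rw [SimpleGraph.mem_edgeSet, SimpleGraph.fromEdgeSet_adj] at this
      exact ⟨this.1, mem_edges.2 this.2⟩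
  exact ⟨p.edges.toFinset, fun e he => (hmem e he).1, fun e he => (hmem e he).2, by
    rw [hval, boundary_walk]⟩

/-- The vertices that can be reached from `v` by edges in `H`. -/
noncomputable def component (H : Set (Sym2 V)) (v : V) : Finset V :=
  open Classical in Finset.univ.filter fun u => (SimpleGraph.fromEdgeSet H).Reachable v u

theorem mem_component {H : Set (Sym2 V)} {u v : V} :
    u ∈ component H v ↔ (SimpleGraph.fromEdgeSet H).Reachable v u := by
  simp [component]

theorem self_mem_component (H : Set (Sym2 V)) (v : V) : v ∈ component H v :=
  mem_component.2 (SimpleGraph.Reachable.refl v)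

theorem notMem_of_mem_cut_component {H : Set (Sym2 V)} {v : V} {e : Sym2 V}
    (he : e ∈ cut (component H v)) : e ∉ H := by
  induction e with
  | _ a b =>
    intro hH
    have hne : a ≠ b := mem_edges.1 (cut_subset_edges _ he)
    have hadj : (SimpleGraph.fromEdgeSet H).Adj a b := by
      rw [SimpleGraph.fromEdgeSet_adj]; exact ⟨hH, hne⟩
    simp only [mem_cut, mem_component] at he
    rcases he with ⟨h, h'⟩ | ⟨h, h'⟩
    · exact h' (h.trans hadj.reachable)
    · exact h' (h.trans hadj.symm.reachable)

theorem exists_mem_cut_of_mem_of_notMem {G : SimpleGraph V} {S : Finset V} {u v : V}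
    (p : G.Walk u v) (h : u ∈ S ↔ v ∉ S) : ∃ e ∈ p.edges, e ∈ cut S := by
  by_contra! hno
  have h1 := sum_map_coboundary (p.edges : Multiset (Sym2 V)) (indicator S)
  rw [boundary_walk] at h1
  rw [Multiset.sum_eq_zero] at h1
  · simp [Finset.sum_add_distrib, Pi.single_apply, indicator] at h1
    by_cases hu : u ∈ S <;> by_cases hv : v ∈ S <;> simp_all
  · intro x hx
    obtain ⟨e, he, rfl⟩ := Multiset.mem_map.1 hx
    rw [coboundary_indicator, if_neg (hno e he)]

/-- Connectedness in terms of cuts. -/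
theorem connected_iff_cut {J : Finset (Sym2 V)} [Nonempty V] :
    (SimpleGraph.fromEdgeSet (J : Set (Sym2 V))).Connected ↔
      ∀ S : Finset V, S.Nonempty → S ≠ Finset.univ → (cut S ∩ J).Nonempty := by
  constructor
  · rintro hJ S ⟨u, hu⟩ hS
    obtain ⟨v, hv⟩ : ∃ v, v ∉ S := by
      by_contra! h
      exact hS (Finset.eq_univ_iff_forall.2 h)
    obtain ⟨p⟩ := hJ.preconnected u v
    obtain ⟨e, he, heS⟩ := exists_mem_cut_of_mem_of_notMem p (S := S) (by tauto)
    have h3 := p.edges_subset_edgeSet he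
    refine ⟨e, Finset.mem_inter.2 ⟨heS, ?_⟩⟩
    rw [SimpleGraph.edgeSet_fromEdgeSet] at h3
    exact h3.1
  · intro h
    refine (SimpleGraph.connected_iff _).2 ⟨fun u v => ?_, inferInstance⟩
    rw [← mem_component]
    by_contra hv
    obtain ⟨e, he⟩ := h (component (J : Set (Sym2 V)) u) ⟨u, self_mem_component _ u⟩
      (fun huniv => hv (huniv ▸ Finset.mem_univ v))
    rw [Finset.mem_inter] at he
    exact notMem_of_mem_cut_component he.1 he.2

/-! ### Weights of symmetric differences -/

theorem pi_zmod_two : (2 : V → ZMod 2) = 0 := by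
  ext v; exact (by decide : (2 : ZMod 2) = 0)

theorem sum_symmDiff_add {α : Type*} [DecidableEq α] (A B : Finset α) (c : α → ℕ) :
    ∑ e ∈ symmDiff A B, c e + 2 * ∑ e ∈ A ∩ B, c e = ∑ e ∈ A, c e + ∑ e ∈ B, c e := by
  rw [symmDiff_def, Finset.sup_eq_union, Finset.sum_union disjoint_sdiff_sdiff,
    ← Finset.sum_inter_add_sum_sdiff A B, ← Finset.sum_inter_add_sum_sdiff B A,
    Finset.inter_comm B A]
  ring

theorem sum_symmDiff_of_eq_zero {α : Type*} [DecidableEq α] (A B : Finset α) (c : α → ℕ)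
    (h : ∀ e ∈ B, c e = 0) : ∑ e ∈ symmDiff A B, c e = ∑ e ∈ A, c e := by
  have h1 := sum_symmDiff_add A B c
  rw [Finset.sum_eq_zero h, Finset.sum_eq_zero fun e he => h e (Finset.mem_inter.1 he).2] at h1
  simpa using h1

theorem sum_symmDiff_singleton {α : Type*} [DecidableEq α] (A : Finset α) (e : α) (c : α → ℕ)
    (h : e ∈ A) : ∑ f ∈ symmDiff A {e}, c f + c e = ∑ f ∈ A, c f := by
  have h1 := sum_symmDiff_add A {e} c
  rw [Finset.inter_singleton_of_mem h, Finset.sum_singleton] at h1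
  omega

theorem symmDiff_subset {α : Type*} [DecidableEq α] {A B C : Finset α} (hA : A ⊆ C) (hB : B ⊆ C) :
    symmDiff A B ⊆ C := fun e he => by
  rw [Finset.mem_symmDiff] at he
  rcases he with h | h
  · exact hA h.1
  · exact hB h.1

theorem boundary_finset_singleton (u v : V) :
    boundary ({s(u, v)} : Finset (Sym2 V)).val = (Pi.single u 1 + Pi.single v 1 : V → ZMod 2) :=
  boundary_singleton u v

/-- Toggling a set `C` whose edges of positive weight lie in exactly one of `A` and `B`. -/
theorem sum_symmDiff_add_sum_symmDiff {α : Type*} [DecidableEq α] (A B C : Finset α) (c : α → ℕ)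
    (h : ∀ e ∈ C, c e = 0 ∨ e ∈ symmDiff A B) :
    ∑ e ∈ symmDiff A C, c e + ∑ e ∈ symmDiff B C, c e = ∑ e ∈ A, c e + ∑ e ∈ B, c e := by
  have hA := sum_symmDiff_add A C c
  have hB := sum_symmDiff_add B C c
  have hC : ∑ e ∈ A ∩ C, c e + ∑ e ∈ B ∩ C, c e = ∑ e ∈ C, c e := by
    rw [Finset.inter_comm A, Finset.inter_comm B, ← Finset.sum_ite_mem, ← Finset.sum_ite_mem,
      ← Finset.sum_add_distrib]
    refine Finset.sum_congr rfl fun e he => ?_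
    rcases h e he with h | h
    · simp [h]
    · rw [Finset.mem_symmDiff] at h
      rcases h with h | h <;> simp [h.1, h.2]
  omega

/-- Sets of edges with the same boundary have weights of the same parity, if the weights are given
by a coboundary modulo 2. -/
theorem sum_mod_two_eq {c : Sym2 V → ℕ} {φ : V → ZMod 2}
    (hφ : ∀ e ∈ edges V, (c e : ZMod 2) = coboundary φ e) {A B : Finset (Sym2 V)}
    (hA : A ⊆ edges V) (hB : B ⊆ edges V) (h : boundary A.val = boundary B.val) :
    (∑ e ∈ A, c e) % 2 = (∑ e ∈ B, c e) % 2 := by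
  have key : ∀ A ⊆ edges V, ((∑ e ∈ A, c e : ℕ) : ZMod 2) = ∑ v, boundary A.val v * φ v := by
    intro A hA
    rw [← sum_map_coboundary, Nat.cast_sum]
    exact Finset.sum_congr rfl fun e he => hφ e (hA he)
  rw [← Nat.ModEq, ← ZMod.natCast_eq_natCast_iff, key A hA, key B hB, h]

/-! ### Packing cuts and the join inequality -/

theorem exists_end_of_mem_cut {S : Finset V} {e : Sym2 V} (he : e ∈ cut S) :
    ∃ u v : V, u ∈ S ∧ v ∉ S ∧ e = s(u, v) := (Finset.mem_filter.1 he).2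

theorem mem_component_of_mem {H : Set (Sym2 V)} {S : Finset V} (hH : ∀ e ∈ cut S, e ∉ H)
    {u v : V} (h : (SimpleGraph.fromEdgeSet H).Reachable u v) : u ∈ S ↔ v ∈ S := by
  obtain ⟨p⟩ := h
  by_contra hne
  obtain ⟨e, he, heS⟩ := exists_mem_cut_of_mem_of_notMem p (S := S) (by tauto)
  have h3 := p.edges_subset_edgeSet he
  rw [SimpleGraph.edgeSet_fromEdgeSet] at h3
  exact hH e heS h3.1

/-- If `D` has boundary `a + b` with `a ∉ S`, `b ∈ S`, and at least two edges of `D` leave `S`,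
then two edges of `D` leaving `S` have outer ends that are connected outside of `S`. -/
theorem exists_pair_reachable {a b : V} {S : Finset V} {D : Finset (Sym2 V)} {Z : Set (Sym2 V)}
    (hD : boundary D.val = (Pi.single a 1 + Pi.single b 1 : V → ZMod 2))
    (hb : b ∈ S) (hZ : ∀ e ∈ cut S, e ∉ Z) (hcard : 1 < (cut S ∩ D).card) :
    ∃ s₁ s₂ u₁ u₂ : V, s₁ ∈ S ∧ s₂ ∈ S ∧ u₁ ∉ S ∧ u₂ ∉ S ∧ s(s₁, u₁) ∈ D ∧ s(s₂, u₂) ∈ D ∧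
      s(s₁, u₁) ≠ s(s₂, u₂) ∧
      (SimpleGraph.fromEdgeSet (Z ∪ (↑D \ ↑(cut S)))).Reachable u₁ u₂ := by
  set H : Set (Sym2 V) := Z ∪ (↑D \ ↑(cut S)) with hH
  have hHS : ∀ e ∈ cut S, e ∉ H := by
    rintro e he (h | h)
    · exact hZ e he h
    · exact h.2 he
  -- If `u` is not connected to `a`, its component in `H` stays outside `S` and contains neither `a`
  -- nor `b`. So `D` leaves it an even number of times, and a second edge leaving it besides `s(s,
  -- u)` must lie in `cut S`, since otherwise it would belong to `H`.
  have key : ∀ s u, s ∈ S → u ∉ S → s(s, u) ∈ D →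
      ¬ (SimpleGraph.fromEdgeSet H).Reachable u a → ∃ s₂ u₂ : V, s₂ ∈ S ∧ u₂ ∉ S ∧
      s(s₂, u₂) ∈ D ∧ s(s, u) ≠ s(s₂, u₂) ∧ (SimpleGraph.fromEdgeSet H).Reachable u u₂ := by
    intro s u hs hu hsu hua
    have hK : ∀ w ∈ component H u, w ∉ S := fun w hw hwS =>
      hu ((mem_component_of_mem hHS (mem_component.1 hw)).2 hwS)
    have heven := natCast_card_cut D (component H u)
    have haK : a ∉ component H u := fun h => hua (mem_component.1 h)
    have hbK : b ∉ component H u := fun h => hK b h hb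
    rw [hD] at heven
    have hzero : ∑ v ∈ component H u, (Pi.single a 1 + Pi.single b 1 : V → ZMod 2) v = 0 := by
      refine Finset.sum_eq_zero fun v hv => ?_
      rw [Pi.add_apply, Pi.single_eq_of_ne (by rintro rfl; exact haK hv),
        Pi.single_eq_of_ne (by rintro rfl; exact hbK hv), add_zero]
    rw [hzero, ZMod.natCast_eq_zero_iff_even] at heven
    have hmem : s(s, u) ∈ cut (component H u) ∩ D := by
      refine Finset.mem_inter.2 ⟨mem_cut.2 (Or.inr ⟨self_mem_component _ _, fun h => hK s h hs⟩),
        hsu⟩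
    have h2 : 1 < (cut (component H u) ∩ D).card := by
      have := Finset.card_pos.2 ⟨_, hmem⟩
      rcases heven with ⟨k, hk⟩
      omega
    obtain ⟨e, he, hne⟩ := Finset.exists_mem_ne h2 s(s, u)
    rw [Finset.mem_inter] at he
    have heS : e ∈ cut S := by
      by_contra h
      exact notMem_of_mem_cut_component he.1 (Or.inr ⟨he.2, h⟩)
    obtain ⟨s₂, u₂, hs₂, hu₂, rfl⟩ := exists_end_of_mem_cut heS
    refine ⟨s₂, u₂, hs₂, hu₂, he.2, hne.symm, ?_⟩
    rcases mem_cut.1 he.1 with h | h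
    · exact absurd hs₂ (hK _ h.1)
    · exact mem_component.1 h.1
  obtain ⟨e, he, e', he', hne⟩ := Finset.one_lt_card.1 hcard
  rw [Finset.mem_inter] at he he'
  obtain ⟨s, u, hs, hu, rfl⟩ := exists_end_of_mem_cut he.1
  obtain ⟨s', u', hs', hu', rfl⟩ := exists_end_of_mem_cut he'.1
  by_cases hua : (SimpleGraph.fromEdgeSet H).Reachable u a
  · by_cases hua' : (SimpleGraph.fromEdgeSet H).Reachable u' a
    · exact ⟨s, s', u, u', hs, hs', hu, hu', he.2, he'.2, hne, hua.trans hua'.symm⟩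
    · obtain ⟨s₂, u₂, h⟩ := key s' u' hs' hu' he'.2 hua'
      exact ⟨s', s₂, u', u₂, hs', h.1, hu', h.2.1, he'.2, h.2.2⟩
  · obtain ⟨s₂, u₂, h⟩ := key s u hs hu he.2 hua
    exact ⟨s, s₂, u, u₂, hs, h.1, hu, h.2.1, he.2, h.2.2⟩

theorem sum_single_one (S : Finset V) (a : V) :
    ∑ v ∈ S, (Pi.single a 1 : V → ZMod 2) v = if a ∈ S then 1 else 0 := by
  simp [Pi.single_apply]

/-- In the situation of `exists_pair_reachable`, if `S` is connected by `Z`, there is a cycle using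
exactly two edges of `cut S`, with all edges in `Z` or `D`. -/
theorem exists_cycle_through {a b : V} {S : Finset V} {D : Finset (Sym2 V)} {Z : Set (Sym2 V)}
    (hDE : D ⊆ edges V)
    (hD : boundary D.val = (Pi.single a 1 + Pi.single b 1 : V → ZMod 2))
    (hb : b ∈ S) (hZ : ∀ e ∈ cut S, e ∉ Z) (hcard : 1 < (cut S ∩ D).card)
    (hS : ∀ u ∈ S, ∀ v ∈ S, (SimpleGraph.fromEdgeSet Z).Reachable u v) :
    ∃ C ⊆ edges V, boundary C.val = 0 ∧ (∀ e ∈ C, e ∈ Z ∨ e ∈ D) ∧ ∃ e₁ e₂, e₁ ≠ e₂ ∧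
      e₁ ∈ cut S ∩ D ∧ e₂ ∈ cut S ∩ D ∧ ∀ e ∈ cut S, e ∈ C ↔ e ∈ ({e₁, e₂} : Finset (Sym2 V)) := by
  obtain ⟨s₁, s₂, u₁, u₂, hs₁, hs₂, hu₁, hu₂, h₁D, h₂D, hne, hreach⟩ :=
    exists_pair_reachable hD hb hZ hcard
  have h₁S : s(s₁, u₁) ∈ cut S := mem_cut.2 (Or.inl ⟨hs₁, hu₁⟩)
  have h₂S : s(s₂, u₂) ∈ cut S := mem_cut.2 (Or.inl ⟨hs₂, hu₂⟩)
  obtain ⟨P, hPH, hPE, hP⟩ := exists_path_of_reachable hreach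
  obtain ⟨Q, hQZ, hQE, hQ⟩ := exists_path_of_reachable (hS s₁ hs₁ s₂ hs₂)
  refine ⟨symmDiff (symmDiff (symmDiff {s(s₁, u₁)} {s(s₂, u₂)}) P) Q,
    symmDiff_subset (symmDiff_subset (symmDiff_subset (Finset.singleton_subset_iff.2 (hDE h₁D))
      (Finset.singleton_subset_iff.2 (hDE h₂D))) hPE) hQE, ?_, ?_, s(s₁, u₁), s(s₂, u₂), hne,
    Finset.mem_inter.2 ⟨h₁S, h₁D⟩, Finset.mem_inter.2 ⟨h₂S, h₂D⟩, ?_⟩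
  · rw [boundary_symmDiff, boundary_symmDiff, boundary_symmDiff, hP, hQ,
      boundary_finset_singleton, boundary_finset_singleton]
    linear_combination (Pi.single s₁ 1 + Pi.single s₂ 1 + Pi.single u₁ 1 + Pi.single u₂ 1) *
      pi_zmod_two (V := V)
  · intro e he
    have h1 : e ∈ Q → e ∈ Z := fun h => hQZ h
    have h2 : e ∈ P → e ∈ Z ∨ e ∈ D := fun h => (hPH h).imp id fun h => h.1
    have h3 : e = s(s₁, u₁) → e ∈ D := fun h => h ▸ h₁D
    have h4 : e = s(s₂, u₂) → e ∈ D := fun h => h ▸ h₂D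
    simp only [Finset.mem_symmDiff, Finset.mem_singleton] at he
    clear * - he h1 h2 h3 h4
    tauto
  · intro e he
    have h1 : e ∉ P := fun h => (hPH h).elim (hZ e he) fun h => h.2 he
    have h2 : e ∉ Q := fun h => hZ e he (hQZ h)
    have h3 : e = s(s₁, u₁) → e ≠ s(s₂, u₂) := by rintro rfl; exact hne
    simp only [Finset.mem_symmDiff, Finset.mem_singleton, Finset.mem_insert]
    clear * - h1 h2 h3
    tauto

/-- The key step towards a packing of cuts: lowering the weights on `cut S` by one lowers the
minimum weight of a join by at most one. -/
theorem exists_reducing_cut {c : Sym2 V → ℕ} {φ : V → ZMod 2}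
    (hφ : ∀ e ∈ edges V, (c e : ZMod 2) = coboundary φ e) {τ : V → ZMod 2}
    {F : Finset (Sym2 V)} (hF : F ⊆ edges V) (hFτ : boundary F.val = τ)
    (hmin : ∀ G ⊆ edges V, boundary G.val = τ → ∑ e ∈ F, c e ≤ ∑ e ∈ G, c e)
    (hpos : 0 < ∑ e ∈ F, c e) :
    ∃ S : Finset V, ∑ v ∈ S, τ v = 1 ∧ (∀ e ∈ cut S, 1 ≤ c e) ∧ (cut S).Nonempty ∧
      ∀ G ⊆ edges V, boundary G.val = τ →
        ∑ e ∈ F, c e + (cut S ∩ G).card ≤ ∑ e ∈ G, c e + 1 := by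
  obtain ⟨f, hfF, hf⟩ : ∃ f ∈ F, 0 < c f := by
    by_contra! h
    exact hpos.ne' (Finset.sum_eq_zero fun e he => Nat.le_zero.1 (h e he))
  obtain ⟨a, a', rfl⟩ : ∃ a a', f = s(a, a') := by
    induction f with
    | _ a a' => exact ⟨a, a', rfl⟩
  classical
  -- The end `a` of a positive edge of `F` is fixed while the other end `b` is free, so `B` is
  -- optimal over all choices of `b` as well. The choice `b = a` admits `F` itself, and `b = a'`
  -- admits `F` without the edge `f`.
  obtain ⟨B, hBmem, hBmin⟩ := Finset.exists_min_image
    ((edges V).powerset.filter fun G => ∃ v, boundary G.val = τ + Pi.single a 1 + Pi.single v 1)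
    (fun G => ∑ e ∈ G, c e) ⟨F, by
      rw [Finset.mem_filter, Finset.mem_powerset]
      exact ⟨hF, a, by linear_combination hFτ - Pi.single a 1 * pi_zmod_two (V := V)⟩⟩
  simp only [Finset.mem_filter, Finset.mem_powerset, and_imp, forall_exists_index] at hBmem hBmin
  obtain ⟨hB, b, hBb⟩ := hBmem
  have hlt : ∑ e ∈ B, c e < ∑ e ∈ F, c e := by
    have h1 := hBmin (symmDiff F {s(a, a')})
      (symmDiff_subset hF (Finset.singleton_subset_iff.2 (hF hfF))) a' (by
        rw [boundary_symmDiff, hFτ, boundary_finset_singleton, add_assoc])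
    have h2 := sum_symmDiff_singleton F _ c hfF
    omega
  set Z : Set (Sym2 V) := {e | c e = 0} with hZ
  set S := component Z b with hS
  have hbS : b ∈ S := self_mem_component Z b
  have hSpos : ∀ e ∈ cut S, e ∉ Z := fun e he => notMem_of_mem_cut_component he
  -- Otherwise a path of weight zero from `b` to `a` would turn `B` into a join for `τ` cheaper than
  -- `F`.
  have haS : a ∉ S := by
    intro ha
    obtain ⟨P, hPZ, hPE, hP⟩ := exists_path_of_reachable (mem_component.1 ha)
    have h1 := hmin (symmDiff B P) (symmDiff_subset hB hPE) (by
      rw [boundary_symmDiff, hBb, hP]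
      linear_combination (Pi.single a 1 + Pi.single b 1) * pi_zmod_two (V := V))
    rw [sum_symmDiff_of_eq_zero B P c fun e he => hPZ he] at h1
    omega
  -- Removing the cut edge and adding a path of weight zero moves the free end from `b` to `u`.
  -- Optimality of `B` then gives a gap of at least `c s(s, u) ≥ 1`, and equality of parities raises
  -- it to 2.
  have hmeet : ∀ G ⊆ edges V, boundary G.val = τ + Pi.single a 1 + Pi.single b 1 →
      (cut S ∩ G).Nonempty → ∑ e ∈ B, c e + 2 ≤ ∑ e ∈ G, c e := by
    rintro G hG hGb ⟨e, he⟩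
    rw [Finset.mem_inter] at he
    obtain ⟨s, u, hs, hu, rfl⟩ := exists_end_of_mem_cut he.1
    obtain ⟨P, hPZ, hPE, hP⟩ := exists_path_of_reachable (mem_component.1 hs)
    have h1 := hBmin (symmDiff (symmDiff G {s(s, u)}) P)
      (symmDiff_subset (symmDiff_subset hG (Finset.singleton_subset_iff.2 (hG he.2))) hPE) u (by
        rw [boundary_symmDiff, boundary_symmDiff, hGb, hP, boundary_finset_singleton]
        linear_combination (Pi.single s 1 + Pi.single b 1) * pi_zmod_two (V := V))
    rw [sum_symmDiff_of_eq_zero _ P c fun e he => hPZ he] at h1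
    have h2 := sum_symmDiff_singleton G _ c he.2
    have h3 : c s(s, u) ≠ 0 := hSpos _ he.1
    have h4 := sum_mod_two_eq hφ hG hB (hGb.trans hBb.symm)
    omega
  have hBS : cut S ∩ B = ∅ := by
    by_contra h
    have := hmeet B hB hBb (Finset.nonempty_iff_ne_empty.2 h)
    omega
  have hBS' : ∀ e ∈ cut S, e ∉ B := fun e he h =>
    Finset.notMem_empty e (hBS ▸ Finset.mem_inter.2 ⟨he, h⟩)
  refine ⟨S, ?_, fun e he => Nat.one_le_iff_ne_zero.2 (hSpos e he),
    ⟨s(b, a), mem_cut.2 (Or.inl ⟨hbS, haS⟩)⟩, ?_⟩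
  · have h1 := natCast_card_cut B S
    rw [hBS, Finset.card_empty, Nat.cast_zero, hBb] at h1
    simp only [Pi.add_apply, Finset.sum_add_distrib, sum_single_one, haS, hbS, if_true,
      if_false, add_zero] at h1
    have : ∀ x : ZMod 2, 0 = x + 1 → x = 1 := by decide
    exact this _ h1
  · intro G
    induction hn : (cut S ∩ G).card using Nat.strong_induction_on generalizing G with
    | _ n ih =>
      intro hG hGτ
      rcases Nat.lt_or_ge 1 n with h1n | hn1
      swap
      · have := hmin G hG hGτ
        omega
      -- With at least two edges of `G` in the cut, toggling a cycle `C` removes exactly two of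
      -- them. The total weight of `G` and `B` is preserved, while `B` becomes heavier by at least 2
      -- because it now meets the cut. So `G` becomes lighter by at least 2, and induction applies.
      set D := symmDiff G B with hD
      have hDS : cut S ∩ D = cut S ∩ G := by
        ext e
        have := hBS' e
        simp only [hD, Finset.mem_inter, Finset.mem_symmDiff]
        tauto
      obtain ⟨C, hCE, hC0, hCZD, e₁, e₂, hne, h₁, h₂, hCS⟩ :=
        exists_cycle_through (a := a) (b := b) (S := S) (D := D) (Z := Z)
          (symmDiff_subset hG hB) (by
          rw [boundary_symmDiff, hGτ, hBb]
          linear_combination τ * pi_zmod_two (V := V)) hbS hSpos (by rw [hDS, hn]; exact h1n)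
          fun u hu v hv => (mem_component.1 hu).symm.trans (mem_component.1 hv)
      have hGC : cut S ∩ symmDiff G C = (cut S ∩ G) \ {e₁, e₂} := by
        rw [hDS] at h₁ h₂
        have hsub : ∀ e ∈ ({e₁, e₂} : Finset (Sym2 V)), e ∈ G := by
          simp only [Finset.mem_insert, Finset.mem_singleton, forall_eq_or_imp, forall_eq]
          exact ⟨(Finset.mem_inter.1 h₁).2, (Finset.mem_inter.1 h₂).2⟩
        ext e
        have h3 := hsub e
        have h4 := hCS e
        simp only [Finset.mem_inter, Finset.mem_symmDiff, Finset.mem_sdiff]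
        clear * - h3 h4
        tauto
      have hcard : (cut S ∩ symmDiff G C).card = n - 2 := by
        rw [hGC, Finset.card_sdiff_of_subset, hn, Finset.card_pair hne]
        rw [← hDS]
        exact Finset.insert_subset h₁ (Finset.singleton_subset_iff.2 h₂)
      have hweight := sum_symmDiff_add_sum_symmDiff G B C c hCZD
      have h₁S := (Finset.mem_inter.1 h₁).1
      have hheavy := hmeet (symmDiff B C) (symmDiff_subset hB hCE)
        (by rw [boundary_symmDiff, hC0, hBb, add_zero])
        ⟨e₁, Finset.mem_inter.2 ⟨h₁S, Finset.mem_symmDiff.2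
          (Or.inr ⟨(hCS _ h₁S).2 (Finset.mem_insert_self _ _), hBS' _ h₁S⟩)⟩⟩
      have hih := ih (n - 2) (by omega) (symmDiff G C) hcard (symmDiff_subset hG hCE)
        (by rw [boundary_symmDiff, hC0, hGτ, add_zero])
      omega

/-- Lowering the weights on a reducing cut costs the join at most 1 and the right-hand side `y(δ(S))
≥ 1`. Weights stay a coboundary modulo 2, since the indicator of `S` is added to the potential, so
the induction on the total weight continues. -/
theorem exists_join_le_of_nat (n : ℕ) {τ : V → ZMod 2} {F₀ : Finset (Sym2 V)}
    (hF₀ : F₀ ⊆ edges V) (hτ : boundary F₀.val = τ) {y : Sym2 V → ℝ} (hy : ∀ e ∈ edges V, 0 ≤ y e)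
    (hcut : ∀ S : Finset V, ∑ v ∈ S, τ v = 1 → 1 ≤ ∑ e ∈ cut S, y e) :
    ∀ (c : Sym2 V → ℕ) (φ : V → ZMod 2) (_ : ∀ e ∈ edges V, (c e : ZMod 2) = coboundary φ e),
      ∑ e ∈ edges V, c e = n → ∃ F ⊆ edges V, boundary F.val = τ ∧
        ((∑ e ∈ F, c e : ℕ) : ℝ) ≤ ∑ e ∈ edges V, c e * y e := by
  induction n using Nat.strong_induction_on with
  | _ n ih =>
    intro c φ hφ hn
    classical
    obtain ⟨F, hF, hmin⟩ := Finset.exists_min_image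
      ((edges V).powerset.filter fun G => boundary G.val = τ) (fun G => ∑ e ∈ G, c e)
      ⟨F₀, by simp [hF₀, hτ]⟩
    simp only [Finset.mem_filter, Finset.mem_powerset, and_imp] at hF hmin
    rcases Nat.eq_zero_or_pos (∑ e ∈ F, c e) with h0 | hpos
    · refine ⟨F, hF.1, hF.2, ?_⟩
      rw [h0, Nat.cast_zero]
      exact Finset.sum_nonneg fun e he => mul_nonneg (Nat.cast_nonneg _) (hy e he)
    obtain ⟨S, hSτ, hS1, hSne, hS⟩ := exists_reducing_cut hφ hF.1 hF.2 hmin hpos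
    set c' : Sym2 V → ℕ := fun e => c e - if e ∈ cut S then 1 else 0 with hc'
    have hcc' : ∀ e, c e = c' e + if e ∈ cut S then 1 else 0 := fun e => by
      simp only [hc']
      split_ifs with h
      · have := hS1 e h; omega
      · omega
    have hsum : ∀ G : Finset (Sym2 V), ∑ e ∈ G, c e = ∑ e ∈ G, c' e + (cut S ∩ G).card := by
      intro G
      rw [Finset.sum_congr rfl fun e _ => hcc' e, Finset.sum_add_distrib, Finset.sum_boole,
        Finset.filter_mem_eq_inter, Finset.inter_comm, Nat.cast_id]
    obtain ⟨G, hG, hGτ, hle⟩ := ih (∑ e ∈ edges V, c' e) (by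
        rw [← hn, hsum, Finset.inter_eq_left.2 (cut_subset_edges S)]
        have := hSne.card_pos
        omega) c' (φ + indicator S) (fun e he => by
        have h1 := hφ e he
        have h2 := coboundary_indicator S e
        have h3 : coboundary (φ + indicator S) e = coboundary φ e + coboundary (indicator S) e := by
          induction e with
          | _ a b => simp only [coboundary_mk, Pi.add_apply]; ring
        have h4 := congrArg (Nat.cast : ℕ → ZMod 2) (hcc' e)
        rw [h3, ← h1, h2, h4]
        push_cast
        rw [add_assoc, zmod_two_add_self, add_zero]) rfl
    refine ⟨F, hF.1, hF.2, ?_⟩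
    have h1 := hS G hG hGτ
    rw [hsum G] at h1
    have h2 : ∑ e ∈ edges V, (c e : ℝ) * y e
        = ∑ e ∈ edges V, (c' e : ℝ) * y e + ∑ e ∈ cut S, y e := by
      rw [← Finset.inter_eq_right.2 (cut_subset_edges S), ← Finset.sum_ite_mem,
        ← Finset.sum_add_distrib]
      refine Finset.sum_congr rfl fun e _ => ?_
      rw [hcc' e]
      split_ifs <;> push_cast <;> ring
    have h3 := hcut S hSτ
    have h4 : ((∑ e ∈ F, c e : ℕ) : ℝ) ≤ (∑ e ∈ G, c' e : ℕ) + 1 := by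
      exact_mod_cast (by omega : ∑ e ∈ F, c e ≤ ∑ e ∈ G, c' e + 1)
    linarith

/-- The dominant of the `T`-join polytope is described by the `T`-cut inequalities. -/
theorem join_cost_le {τ : V → ZMod 2} {F : Finset (Sym2 V)} {c : Sym2 V → ℝ}
    (hc : ∀ e ∈ edges V, 0 ≤ c e) (hF : F ⊆ edges V) (hτ : boundary F.val = τ)
    (hmin : ∀ G ⊆ edges V, boundary G.val = τ → ∑ e ∈ F, c e ≤ ∑ e ∈ G, c e)
    {y : Sym2 V → ℝ} (hy : ∀ e ∈ edges V, 0 ≤ y e)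
    (hcut : ∀ S : Finset V, ∑ v ∈ S, τ v = 1 → 1 ≤ ∑ e ∈ cut S, y e) :
    ∑ e ∈ F, c e ≤ ∑ e ∈ edges V, c e * y e := by
  have key : ∀ n : ℕ, (n : ℝ) * (∑ e ∈ F, c e - ∑ e ∈ edges V, c e * y e)
      ≤ ∑ e ∈ edges V, y e := by
    intro n
    -- Costs are scaled by `n` and rounded up; doubling makes all weights even, so the zero
    -- potential works. The rounding error is at most `y(E)`, independently of `n`.
    obtain ⟨G, hG, hGτ, hle⟩ := exists_join_le_of_nat _ hF hτ hy hcut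
      (fun e => 2 * ⌈n * c e⌉₊) 0 (fun e _ => by
        induction e with
        | _ a b =>
          have : (2 : ZMod 2) = 0 := by decide
          simp [this]) rfl
    have h1 : (n : ℝ) * ∑ e ∈ G, c e ≤ ∑ e ∈ G, (⌈n * c e⌉₊ : ℝ) := by
      rw [Finset.mul_sum]
      exact Finset.sum_le_sum fun e _ => Nat.le_ceil _
    have h2 : ∑ e ∈ edges V, (⌈n * c e⌉₊ : ℝ) * y e
        ≤ ∑ e ∈ edges V, ((n * c e) * y e + y e) := by
      refine Finset.sum_le_sum fun e he => ?_
      rw [← add_one_mul]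
      exact mul_le_mul_of_nonneg_right
        (Nat.ceil_lt_add_one (mul_nonneg (Nat.cast_nonneg _) (hc e he))).le (hy e he)
    push_cast at hle
    rw [← Finset.mul_sum] at hle
    simp_rw [mul_assoc (2 : ℝ)] at hle
    rw [← Finset.mul_sum] at hle
    rw [Finset.sum_add_distrib] at h2
    simp_rw [mul_assoc (n : ℝ)] at h2
    rw [← Finset.mul_sum] at h2
    have h3 := mul_le_mul_of_nonneg_left (hmin G hG hGτ) (Nat.cast_nonneg (α := ℝ) n)
    linarith
  by_contra! hlt
  obtain ⟨n, hn⟩ := exists_nat_gt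
    ((∑ e ∈ edges V, y e) / (∑ e ∈ F, c e - ∑ e ∈ edges V, c e * y e))
  rw [div_lt_iff₀ (by linarith)] at hn
  exact absurd (key n) (not_le.2 hn)

/-! ### Eulerian traversals -/

theorem exists_walk_edges_le {M : Multiset (Sym2 V)} {u v : V}
    (hb : boundary M = (Pi.single u 1 + Pi.single v 1 : V → ZMod 2)) :
    ∃ p : (⊤ : SimpleGraph V).Walk u v, (p.edges : Multiset (Sym2 V)) ≤ M := by
  -- Otherwise the component of `u` would contain exactly one of the two odd vertices although no
  -- edge of `M` leaves it.
  have hv : v ∈ component {e | e ∈ M} u := by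
    by_contra hv
    have h1 := sum_map_coboundary M (indicator (component {e | e ∈ M} u))
    rw [Multiset.sum_eq_zero, hb] at h1
    · simp only [indicator, mul_ite, mul_one, mul_zero, Finset.sum_ite_mem, Finset.univ_inter,
        Pi.add_apply, Finset.sum_add_distrib, sum_single_one, hv, self_mem_component, if_true,
        if_false] at h1
      exact absurd h1 (by decide)
    · intro x hx
      obtain ⟨e, he, rfl⟩ := Multiset.mem_map.1 hx
      rw [coboundary_indicator, if_neg fun h => notMem_of_mem_cut_component h he]
  obtain ⟨p, hp⟩ := (mem_component.1 hv).exists_isPath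
  refine ⟨p.mapLe le_top, ?_⟩
  rw [SimpleGraph.Walk.edges_mapLe_eq_edges, Multiset.le_iff_subset (Multiset.coe_nodup.2 hp.isTrail.edges_nodup)]
  intro e he
  have := p.edges_subset_edgeSet (Multiset.mem_coe.1 he)
  rw [SimpleGraph.edgeSet_fromEdgeSet] at this
  exact this.1

/-- The unused edges have zero boundary, and by connectedness one of them, `s(u, v)`, starts on the
walk. The others contain a path from `v` back to `u`, so a closed detour at `u` lengthens the walk.
-/
theorem exists_walk_edges_eq_of_le {M : Multiset (Sym2 V)} (hM : ∀ e ∈ M, e ∈ edges V)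
    (hconn : ∀ S : Finset V, S.Nonempty → S ≠ Finset.univ → ∃ e ∈ M, e ∈ cut S) {s t : V}
    (hb : boundary M = (Pi.single s 1 + Pi.single t 1 : V → ZMod 2)) (n : ℕ)
    (p : (⊤ : SimpleGraph V).Walk s t) (hp : (p.edges : Multiset (Sym2 V)) ≤ M)
    (hn : M.card - p.length = n) :
    ∃ q : (⊤ : SimpleGraph V).Walk s t, (q.edges : Multiset (Sym2 V)) = M := by
  induction n using Nat.strong_induction_on generalizing p with
  | _ n ih =>
    by_cases heq : (p.edges : Multiset (Sym2 V)) = M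
    · exact ⟨p, heq⟩
    obtain ⟨R, rfl⟩ := Multiset.le_iff_exists_add.1 hp
    have hR : R ≠ 0 := by rintro rfl; simp at heq
    have hRb : boundary R = 0 := by
      rw [boundary_add, boundary_walk] at hb
      simpa using hb
    obtain ⟨u, v, hu, huv⟩ : ∃ u v, u ∈ p.support ∧ s(u, v) ∈ R := by
      by_cases hS : p.support.toFinset = Finset.univ
      · obtain ⟨e, he⟩ := Multiset.exists_mem_of_ne_zero hR
        induction e with
        | _ u v =>
          exact ⟨u, v, List.mem_toFinset.1 (hS ▸ Finset.mem_univ u), he⟩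
      · obtain ⟨e, he, hcut⟩ := hconn p.support.toFinset
          ⟨s, List.mem_toFinset.2 p.start_mem_support⟩ hS
        obtain ⟨u, v, hu, hv, rfl⟩ := exists_end_of_mem_cut hcut
        rw [List.mem_toFinset] at hu hv
        refine ⟨u, v, hu, (Multiset.mem_add.1 he).resolve_left fun h => hv ?_⟩
        exact p.snd_mem_support_of_mem_edges h
    obtain ⟨R', rfl⟩ := Multiset.exists_cons_of_mem huv
    have hne : u ≠ v := mem_edges.1 (hM _ (Multiset.mem_add.2 (Or.inr huv)))
    rw [← Multiset.singleton_add, boundary_add, boundary_singleton] at hRb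
    obtain ⟨q, hq⟩ := exists_walk_edges_le (M := R') (u := v) (v := u) (by
      linear_combination hRb - (Pi.single u 1 + Pi.single v 1) * pi_zmod_two (V := V))
    set r : (⊤ : SimpleGraph V).Walk s t :=
      (p.takeUntil u hu).append ((q.cons (by simpa using hne)).append (p.dropUntil u hu)) with hr
    have hre : (r.edges : Multiset (Sym2 V)) = p.edges + s(u, v) ::ₘ q.edges := by
      conv_rhs => rw [← p.take_spec hu]
      simp only [hr, SimpleGraph.Walk.edges_append, SimpleGraph.Walk.edges_cons,
        ← Multiset.coe_add, ← Multiset.cons_coe]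
      rw [← Multiset.singleton_add]
      abel
    have hrM : (r.edges : Multiset (Sym2 V)) ≤ p.edges + s(u, v) ::ₘ R' := by
      rw [hre]
      exact add_le_add_right ((Multiset.cons_le_cons_iff _).2 hq) _
    have hlen : p.length < r.length := by
      have := congrArg Multiset.card hre
      simp at this
      omega
    have hle := Multiset.card_le_card hrM
    rw [Multiset.coe_card, SimpleGraph.Walk.length_edges] at hle
    exact ih _ (by omega) r hrM rfl

/-- Euler's theorem for multigraphs, in terms of boundaries and cuts. -/
theorem exists_walk_edges_eq {M : Multiset (Sym2 V)} (hM : ∀ e ∈ M, e ∈ edges V)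
    (hconn : ∀ S : Finset V, S.Nonempty → S ≠ Finset.univ → ∃ e ∈ M, e ∈ cut S) {s t : V}
    (hb : boundary M = (Pi.single s 1 + Pi.single t 1 : V → ZMod 2)) :
    ∃ q : (⊤ : SimpleGraph V).Walk s t, (q.edges : Multiset (Sym2 V)) = M := by
  obtain ⟨p, hp⟩ := exists_walk_edges_le hb
  exact exists_walk_edges_eq_of_le hM hconn hb _ p hp rfl

/-! ### Shortcuts and the triangle inequality -/

theorem exists_walk_support_eq (l : List V) (s t : V) (h : (s :: (l ++ [t])).Nodup) :
    ∃ p : (⊤ : SimpleGraph V).Walk s t, p.support = s :: (l ++ [t]) := by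
  induction l generalizing s with
  | nil =>
    have hne : s ≠ t := by simpa using h
    exact ⟨SimpleGraph.Walk.cons (by simpa using hne) SimpleGraph.Walk.nil, rfl⟩
  | cons a l ih =>
    rw [List.cons_append, List.nodup_cons] at h
    obtain ⟨p, hp⟩ := ih a h.2
    have hne : s ≠ a := by rintro rfl; exact h.1 List.mem_cons_self
    exact ⟨p.cons (by simpa using hne), by rw [SimpleGraph.Walk.support_cons, hp]; rfl⟩

theorem exists_isShortcut {s t : V} (hst : s ≠ t) (p : (⊤ : SimpleGraph V).Walk s t)
    (hp : ∀ v, v ∈ p.support) : ∃ q, IsShortcut p q := by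
  cases p with
  | nil => exact absurd rfl hst
  | @cons _ a _ h p =>
    have hlast : p.support = p.support.dropLast ++ [t] := by
      conv_lhs => rw [← List.dropLast_append_getLast (SimpleGraph.Walk.support_ne_nil p),
        SimpleGraph.Walk.getLast_support]
    -- The order keeps the first `s` and the last `t`, and one occurrence of every other vertex in
    -- between.
    set l := (p.support.dropLast.filter fun v => v ≠ s ∧ v ≠ t).dedup with hl
    have hmem : ∀ v, v ∈ l ↔ v ∈ p.support.dropLast ∧ v ≠ s ∧ v ≠ t := by
      intro v
      simp [hl]
    have hnodup : (s :: (l ++ [t])).Nodup := by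
      rw [List.nodup_cons, List.nodup_append]
      refine ⟨?_, List.nodup_dedup _, List.nodup_singleton t, ?_⟩
      · rw [List.mem_append, hmem, List.mem_singleton]
        tauto
      · rintro v hv w hw
        rw [List.mem_singleton.1 hw]
        exact ((hmem v).1 hv).2.2
    obtain ⟨q, hq⟩ := exists_walk_support_eq l s t hnodup
    refine ⟨q, ?_, ?_⟩
    · refine SimpleGraph.Walk.IsPath.isHamiltonian_of_mem ?_ fun v => ?_
      · rw [SimpleGraph.Walk.isPath_def, hq]; exact hnodup
      · have h1 := hp v
        rw [SimpleGraph.Walk.support_cons, hlast] at h1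
        rw [hq]
        simp only [List.mem_cons, List.mem_append, hmem, List.not_mem_nil, or_false] at h1 ⊢
        tauto
    · rw [hq, SimpleGraph.Walk.support_cons, List.cons_sublist_cons, hlast]
      exact ((List.dedup_sublist _).trans List.filter_sublist).append (List.Sublist.refl _)

/-- The length of the walk that starts in `a` and visits the vertices of a list. -/
def tourLength (c : Sym2 V → ℝ) : V → List V → ℝ
  | _, [] => 0
  | a, b :: l => (if a = b then 0 else c s(a, b)) + tourLength c b l

theorem walkCost_eq_tourLength (c : Sym2 V → ℝ) {s t : V} (p : (⊤ : SimpleGraph V).Walk s t) :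
    walkCost c p = tourLength c s p.support.tail := by
  induction p with
  | nil => simp [walkCost, tourLength]
  | @cons a b d h p ih =>
    have hne : a ≠ b := h.ne
    rw [SimpleGraph.Walk.support_cons, List.tail_cons, ← SimpleGraph.Walk.cons_tail_support p,
      tourLength, if_neg hne, ← ih]
    simp [walkCost]

theorem IsMetricCost.ite_nonneg {c : Sym2 V → ℝ} (hc : IsMetricCost c) (a b : V) :
    0 ≤ if a = b then 0 else c s(a, b) := by
  split_ifs with h
  · exact le_rfl
  · exact hc.nonneg _ (mem_edges.2 h)

theorem IsMetricCost.ite_triangle {c : Sym2 V → ℝ} (hc : IsMetricCost c) (a b d : V) :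
    (if a = d then 0 else c s(a, d)) ≤
      (if a = b then 0 else c s(a, b)) + if b = d then 0 else c s(b, d) := by
  by_cases hab : a = b
  · subst hab; simp
  by_cases hbd : b = d
  · subst hbd; simp
  by_cases had : a = d
  · rw [if_pos had]
    exact add_nonneg (hc.ite_nonneg _ _) (hc.ite_nonneg _ _)
  rw [if_neg hab, if_neg hbd, if_neg had]
  exact hc.triangle a b d hab hbd had

/-- Each skipped vertex is one use of the triangle inequality. Skipping may leave equal consecutive
vertices, which is why a step from a vertex to itself has length 0 instead of the unconstrained
value of `c` on a loop. -/
theorem IsMetricCost.tourLength_le {c : Sym2 V → ℝ} (hc : IsMetricCost c) {l₁ l₂ : List V}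
    (h : l₁.Sublist l₂) (a : V) : tourLength c a l₁ ≤ tourLength c a l₂ := by
  induction h generalizing a with
  | slnil => exact le_rfl
  | @cons l₁ l₂ b h ih =>
    refine le_trans ?_ (add_le_add_right (ih b) _)
    cases l₁ with
    | nil => simpa [tourLength] using hc.ite_nonneg a b
    | cons d l₁ =>
      simp only [tourLength]
      rw [← add_assoc]
      exact add_le_add_left (hc.ite_triangle a b d) _
  | cons_cons b h ih => exact add_le_add_right (ih b) _

theorem IsShortcut.walkCost_le {c : Sym2 V → ℝ} (hc : IsMetricCost c) {s t : V}
    {p q : (⊤ : SimpleGraph V).Walk s t} (h : IsShortcut p q) : walkCost c q ≤ walkCost c p := by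
  rw [walkCost_eq_tourLength, walkCost_eq_tourLength]
  refine hc.tourLength_le ?_ s
  have := h.2
  rw [← SimpleGraph.Walk.cons_tail_support q, ← SimpleGraph.Walk.cons_tail_support p,
    List.cons_sublist_cons] at this
  exact this

theorem IsEulerianTraversal.walkCost_eq (c : Sym2 V → ℝ) {s t : V} {J F : Finset (Sym2 V)}
    {p : (⊤ : SimpleGraph V).Walk s t} (h : IsEulerianTraversal J F p) :
    walkCost c p = ∑ e ∈ J, c e + ∑ e ∈ F, c e := by
  have := congrArg (fun M => (Multiset.map c M).sum) (show _ = _ from h)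
  rwa [Multiset.map_add, Multiset.sum_add, Multiset.map_coe, Multiset.sum_coe] at this

/-! ### Hamiltonian paths as feasible points -/

theorem exists_mem_edges_mem_cut {G : SimpleGraph V} {s t : V} (p : G.Walk s t)
    (hp : ∀ v, v ∈ p.support) {S : Finset V} (hS : S.Nonempty) (hS' : S ≠ Finset.univ) :
    ∃ e ∈ p.edges, e ∈ cut S := by
  obtain ⟨u, hu⟩ := hS
  obtain ⟨v, hv⟩ : ∃ v, v ∉ S := by
    by_contra! h
    exact hS' (Finset.eq_univ_iff_forall.2 h)
  by_cases hs : s ∈ S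
  · obtain ⟨e, he, h⟩ := exists_mem_cut_of_mem_of_notMem (p.takeUntil v (hp v)) (S := S) (by tauto)
    exact ⟨e, p.edges_takeUntil_subset_edges _ he, h⟩
  · obtain ⟨e, he, h⟩ := exists_mem_cut_of_mem_of_notMem (p.takeUntil u (hp u)) (S := S) (by tauto)
    exact ⟨e, p.edges_takeUntil_subset_edges _ he, h⟩

theorem card_inter_pair {s t : V} (hst : s ≠ t) (S : Finset V) :
    (S ∩ {s, t}).card = (if s ∈ S then 1 else 0) + if t ∈ S then 1 else 0 := by
  by_cases hs : s ∈ S <;> by_cases ht : t ∈ S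
  · rw [Finset.inter_insert_of_mem hs, Finset.inter_singleton_of_mem ht, Finset.card_pair hst,
      if_pos hs, if_pos ht]
  · rw [Finset.inter_insert_of_mem hs, Finset.inter_singleton_of_notMem ht, if_pos hs, if_neg ht]
    rfl
  · rw [Finset.inter_insert_of_notMem hs, Finset.inter_singleton_of_mem ht, if_neg hs, if_pos ht]
    rfl
  · rw [Finset.inter_insert_of_notMem hs, Finset.inter_singleton_of_notMem ht, if_neg hs,
      if_neg ht]
    rfl

/-- The edges with both ends in `S`. -/
def inside (S : Finset V) : Finset (Sym2 V) := (edges V).filter fun e => ∀ v ∈ e, v ∈ S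

theorem mem_inside {S : Finset V} {u v : V} : s(u, v) ∈ inside S ↔ u ≠ v ∧ u ∈ S ∧ v ∈ S := by
  simp [inside, mem_edges]

theorem cut_univ : cut (Finset.univ : Finset V) = ∅ := by
  simp [cut]

theorem inside_univ : inside (Finset.univ : Finset V) = edges V := by
  simp [inside]

theorem sum_cut_eq {R : Type*} [CommSemiring R] (S : Finset V) (x : Sym2 V → R) :
    ∑ e ∈ cut S, x e = ∑ e ∈ edges V, if e ∈ cut S then x e else 0 := by
  rw [Finset.sum_ite_mem, Finset.inter_eq_right.2 (cut_subset_edges S)]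

theorem sum_sum_cut_singleton {R : Type*} [CommSemiring R] (S : Finset V) (x : Sym2 V → R) :
    ∑ v ∈ S, ∑ e ∈ cut {v}, x e = 2 * ∑ e ∈ inside S, x e + ∑ e ∈ cut S, x e := by
  have h1 : ∑ e ∈ inside S, x e = ∑ e ∈ edges V, if e ∈ inside S then x e else 0 := by
    rw [Finset.sum_ite_mem, Finset.inter_eq_right.2 (show inside S ⊆ edges V from Finset.filter_subset _ _)]
  simp_rw [sum_cut_eq, h1]
  rw [Finset.sum_comm, Finset.mul_sum, ← Finset.sum_add_distrib]
  refine Finset.sum_congr rfl fun e he => ?_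
  induction e with
  | _ a b =>
    have hab := mem_edges.1 he
    have h2 : ∀ v, (if s(a, b) ∈ cut {v} then x s(a, b) else 0)
        = (if a = v then x s(a, b) else 0) + if b = v then x s(a, b) else 0 := by
      intro v
      simp only [mem_cut, Finset.mem_singleton]
      by_cases ha : a = v <;> by_cases hb : b = v <;> simp_all
    simp_rw [h2, Finset.sum_add_distrib, Finset.sum_ite_eq, mem_inside, mem_cut]
    by_cases ha : a ∈ S <;> by_cases hb : b ∈ S <;> simp [ha, hb, hab, two_mul]

theorem sum_mem_edges_eq {s t : V} (h : (⊤ : SimpleGraph V).Walk s t)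
    (D : Finset (Sym2 V)) (c : Sym2 V → ℝ) :
    ∑ e ∈ D, c e * (if e ∈ h.edges then 1 else 0) = ∑ e ∈ D ∩ h.edges.toFinset, c e := by
  rw [← Finset.sum_ite_mem]
  refine Finset.sum_congr rfl fun e _ => ?_
  simp

theorem edges_toFinset_val {G : SimpleGraph V} {s t : V} {h : G.Walk s t} (hh : h.IsPath) :
    (h.edges.toFinset).val = (h.edges : Multiset (Sym2 V)) := by
  rw [List.toFinset_val, hh.isTrail.edges_nodup.dedup]

theorem toFinset_edges_subset {s t : V} (h : (⊤ : SimpleGraph V).Walk s t) :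
    h.edges.toFinset ⊆ edges V := fun e he => by
  have := h.edges_subset_edgeSet (List.mem_toFinset.1 he)
  rwa [edges, SimpleGraph.mem_edgeFinset]

theorem lpCost_indicator_eq {s t : V} {h : (⊤ : SimpleGraph V).Walk s t} (hh : h.IsHamiltonian)
    (c : Sym2 V → ℝ) : lpCost c (fun e => if e ∈ h.edges then 1 else 0) = walkCost c h := by
  rw [lpCost, sum_mem_edges_eq h, Finset.inter_eq_right.2 (toFinset_edges_subset h), Finset.sum,
    edges_toFinset_val hh.isPath, Multiset.map_coe, Multiset.sum_coe, walkCost]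

/-- The path crosses every proper cut, with the parity of `|S ∩ {s, t}|`, which yields the cut
constraints. For single vertices this bounds the degrees from below by 1 or 2. These bounds add up
to `2(|V| - 1)`, twice the number of path edges, so all of them are attained. -/
theorem IsHamiltonian.isFeasible {s t : V} (hst : s ≠ t) {h : (⊤ : SimpleGraph V).Walk s t}
    (hh : h.IsHamiltonian) : IsFeasible s t (fun e => if e ∈ h.edges then 1 else 0) := by
  set F := h.edges.toFinset with hF
  have hsum : ∀ D : Finset (Sym2 V), ∑ e ∈ D, (if e ∈ h.edges then (1 : ℝ) else 0)
      = (D ∩ F).card := fun D => by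
    have := sum_mem_edges_eq h D 1
    simpa using this
  have hpar : ∀ S, ((cut S ∩ F).card : ZMod 2) = (S ∩ {s, t}).card := fun S => by
    rw [natCast_card_cut, edges_toFinset_val hh.isPath, boundary_walk, card_inter_pair hst]
    simp only [Pi.add_apply, Finset.sum_add_distrib, sum_single_one]
    push_cast
    rfl
  have hone : ∀ S : Finset V, S.Nonempty → S ≠ Finset.univ → 1 ≤ (cut S ∩ F).card := by
    intro S hS hS'
    obtain ⟨e, he, h⟩ := exists_mem_edges_mem_cut h hh.mem_support hS hS'
    exact Finset.card_pos.2 ⟨e, Finset.mem_inter.2 ⟨h, List.mem_toFinset.2 he⟩⟩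
  have htwo : ∀ S : Finset V, S.Nonempty → S ≠ Finset.univ → Even (S ∩ {s, t}).card →
      2 ≤ (cut S ∩ F).card := by
    intro S hS hS' heven
    have h1 := hone S hS hS'
    have h2 := hpar S
    rw [ZMod.natCast_eq_zero_iff_even.2 heven, ZMod.natCast_eq_zero_iff_even] at h2
    obtain ⟨k, hk⟩ := h2
    omega
  have hproper : ∀ v : V, ({v} : Finset V) ≠ Finset.univ := fun v h => hst
    ((Finset.mem_singleton.1 (h ▸ Finset.mem_univ s)).trans
      (Finset.mem_singleton.1 (h ▸ Finset.mem_univ t)).symm)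
  have hdeg : ∀ v ∈ Finset.univ, (cut {v} ∩ F).card =
      2 - (if v = s then 1 else 0) - (if v = t then 1 else 0) := by
    have hle : ∀ v ∈ Finset.univ, 2 - (if v = s then 1 else 0) - (if v = t then 1 else 0)
        ≤ (cut {v} ∩ F).card := by
      intro v _
      have h1 := hone {v} (Finset.singleton_nonempty v) (hproper v)
      by_cases hs : v = s
      · rw [if_pos hs]; omega
      by_cases ht : v = t
      · rw [if_pos ht]; omega
      rw [if_neg hs, if_neg ht]
      refine htwo {v} (Finset.singleton_nonempty v) (hproper v) ?_
      rw [card_inter_pair hst, if_neg, if_neg] <;> simp [Ne.symm hs, Ne.symm ht]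
    intro v hv
    refine ((Finset.sum_eq_sum_iff_of_le hle).1 ?_ v hv).symm
    have h1 := sum_sum_cut_singleton (R := ℕ) Finset.univ (fun e => if e ∈ F then 1 else 0)
    simp only [cut_univ, inside_univ, Finset.sum_boole, Finset.filter_mem_eq_inter, Nat.cast_id,
      Finset.empty_inter, Finset.card_empty, add_zero] at h1
    rw [h1, Finset.inter_eq_right.2 (toFinset_edges_subset h),
      List.toFinset_card_of_nodup hh.isPath.isTrail.edges_nodup, SimpleGraph.Walk.length_edges,
      hh.length_eq]
    have h2 : ∑ v : V, (2 - (if v = s then 1 else 0) - (if v = t then 1 else 0)) + 2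
        = ∑ v : V, 2 := by
      have h3 : (2 : ℕ) = ∑ v : V, ((if v = s then 1 else 0) + (if v = t then 1 else 0)) := by
        rw [Finset.sum_add_distrib]
        simp
      nth_rewrite 2 [h3]
      rw [← Finset.sum_add_distrib]
      refine Finset.sum_congr rfl fun v _ => ?_
      by_cases hs : v = s
      · have : v ≠ t := fun h => hst (hs.symm.trans h)
        simp [hs, hst]
      · by_cases ht : v = t <;> simp [hs, ht, hst.symm]
    rw [Finset.sum_const, Finset.card_univ, smul_eq_mul] at h2
    have := Fintype.card_pos_iff.2 ⟨s⟩
    omega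
  refine ⟨?_, ?_, fun v hs ht => ?_, fun S hS hS' _ => ?_, fun S hS hS' heven => ?_,
    fun e _ => ?_, fun e _ => ?_⟩
  · rw [hsum, hdeg s (Finset.mem_univ _), if_pos rfl, if_neg hst]; norm_num
  · rw [hsum, hdeg t (Finset.mem_univ _), if_neg hst.symm, if_pos rfl]; norm_num
  · rw [hsum, hdeg v (Finset.mem_univ _), if_neg hs, if_neg ht]; norm_num
  · rw [hsum]; exact_mod_cast hone S hS hS'
  · rw [hsum]; exact_mod_cast htwo S hS hS' heven
  · split_ifs <;> norm_num
  · split_ifs <;> norm_num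

theorem IsFeasible.congr {s t : V} {x y : Sym2 V → ℝ} (hx : IsFeasible s t x)
    (h : ∀ e ∈ edges V, x e = y e) : IsFeasible s t y := by
  have hcut : ∀ S : Finset V, ∑ e ∈ cut S, y e = ∑ e ∈ cut S, x e := fun S =>
    Finset.sum_congr rfl fun e he => (h e (cut_subset_edges S he)).symm
  refine ⟨?_, ?_, ?_, ?_, ?_, fun e he => h e he ▸ hx.nonneg e he,
    fun e he => h e he ▸ hx.le_one e he⟩ <;> simp only [hcut]
  · exact hx.deg_s
  · exact hx.deg_t
  · exact hx.deg_other
  · exact hx.odd_cut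
  · exact hx.even_cut

theorem exists_isHamiltonian {s t : V} (hst : s ≠ t) :
    ∃ h : (⊤ : SimpleGraph V).Walk s t, h.IsHamiltonian := by
  obtain ⟨p, hp⟩ := exists_walk_support_eq
    (Finset.univ.filter fun v => v ≠ s ∧ v ≠ t).toList s t (by
      rw [List.nodup_cons, List.nodup_append]
      refine ⟨by simp [hst], Finset.nodup_toList _, List.nodup_singleton t, ?_⟩
      simp only [Finset.mem_toList, Finset.mem_filter, List.mem_singleton]
      rintro v hv w rfl
      exact hv.2.2)
  obtain ⟨q, hq⟩ := exists_isShortcut hst p (fun v => by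
    rw [hp]
    simp only [List.mem_cons, List.mem_append, Finset.mem_toList, Finset.mem_filter,
      Finset.mem_univ, List.not_mem_nil]
    tauto)
  exact ⟨q, hq.1⟩

/-! ### Existence of an optimal LP solution -/

theorem isClosed_setOf_isFeasible (s t : V) : IsClosed {x : Sym2 V → ℝ | IsFeasible s t x} := by
  have : {x : Sym2 V → ℝ | IsFeasible s t x} = {x | ∑ e ∈ cut {s}, x e = 1} ∩
      ({x | ∑ e ∈ cut {t}, x e = 1} ∩ ({x | ∀ v, v ≠ s → v ≠ t → ∑ e ∈ cut {v}, x e = 2} ∩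
      ({x | ∀ S : Finset V, S.Nonempty → S ≠ Finset.univ → (S ∩ {s, t}).card = 1 →
        1 ≤ ∑ e ∈ cut S, x e} ∩
      ({x | ∀ S : Finset V, S.Nonempty → S ≠ Finset.univ → Even (S ∩ {s, t}).card →
        2 ≤ ∑ e ∈ cut S, x e} ∩
      ({x | ∀ e ∈ edges V, 0 ≤ x e} ∩ {x | ∀ e ∈ edges V, x e ≤ 1}))))) := by
    ext x
    exact ⟨fun h => ⟨h.1, h.2, h.3, h.4, h.5, h.6, h.7⟩,
      fun ⟨h1, h2, h3, h4, h5, h6, h7⟩ => ⟨h1, h2, h3, h4, h5, h6, h7⟩⟩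
  rw [this]
  simp only [Set.ofPred_forall]
  refine (isClosed_eq (by fun_prop) (by fun_prop)).inter <|
    (isClosed_eq (by fun_prop) (by fun_prop)).inter <|
    (isClosed_iInter fun v => isClosed_iInter fun _ => isClosed_iInter fun _ =>
      isClosed_eq (by fun_prop) (by fun_prop)).inter <|
    (isClosed_iInter fun S => isClosed_iInter fun _ => isClosed_iInter fun _ =>
      isClosed_iInter fun _ => isClosed_le (by fun_prop) (by fun_prop)).inter <|
    (isClosed_iInter fun S => isClosed_iInter fun _ => isClosed_iInter fun _ =>
      isClosed_iInter fun _ => isClosed_le (by fun_prop) (by fun_prop)).inter <|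
    (isClosed_iInter fun e => isClosed_iInter fun _ =>
      isClosed_le (by fun_prop) (by fun_prop)).inter <|
    isClosed_iInter fun e => isClosed_iInter fun _ => isClosed_le (by fun_prop) (by fun_prop)

theorem exists_isOptimal (c : Sym2 V → ℝ) {s t : V} (hst : s ≠ t) : ∃ x, IsOptimal c s t x := by
  obtain ⟨h, hh⟩ := exists_isHamiltonian hst
  -- Feasibility and cost ignore the values on loops; setting these to 0 places every feasible point
  -- in a compact cube.
  have hcongr : ∀ y, IsFeasible s t y → IsFeasible s t (fun e => if e ∈ edges V then y e else 0) :=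
    fun y hy => hy.congr fun e he => (if_pos he).symm
  have hcompact : IsCompact ({x : Sym2 V → ℝ | IsFeasible s t x} ∩
      Set.univ.pi fun _ => Set.Icc (0 : ℝ) 1) :=
    (isCompact_univ_pi fun _ => isCompact_Icc).inter_left (isClosed_setOf_isFeasible s t)
  have hmem : ∀ y, IsFeasible s t y → (fun e => if e ∈ edges V then y e else 0) ∈
      {x : Sym2 V → ℝ | IsFeasible s t x} ∩ Set.univ.pi fun _ => Set.Icc (0 : ℝ) 1 :=
    fun y hy => ⟨hcongr y hy, fun e _ => by
      dsimp only
      split_ifs with he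
      · exact ⟨hy.nonneg e he, hy.le_one e he⟩
      · exact ⟨le_rfl, zero_le_one⟩⟩
  have hcont : Continuous (lpCost c) := by
    unfold lpCost
    fun_prop
  obtain ⟨x, hx, hmin⟩ := hcompact.exists_isMinOn
    ⟨_, hmem _ (IsHamiltonian.isFeasible hst hh)⟩ hcont.continuousOn
  refine ⟨x, hx.1, fun y hy => (hmin (hmem y hy)).trans_eq ?_⟩
  exact Finset.sum_congr rfl fun e he => congrArg _ (if_pos he)

/-! ### Spanning trees and their convex hull -/

theorem edgeSet_fromEdgeSet_of_subset {J : Finset (Sym2 V)} (hJ : J ⊆ edges V) :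
    (SimpleGraph.fromEdgeSet (J : Set (Sym2 V))).edgeSet = J := by
  rw [SimpleGraph.edgeSet_fromEdgeSet]
  refine Set.Subset.antisymm Set.sdiff_subset fun e he => ⟨he, ?_⟩
  induction e with
  | _ a b => simpa using mem_edges.1 (hJ he)

theorem isSpanningTree_iff [Nonempty V] {J : Finset (Sym2 V)} (hJ : J ⊆ edges V) :
    IsSpanningTree J ↔ (∀ S : Finset V, S.Nonempty → S ≠ Finset.univ → (cut S ∩ J).Nonempty) ∧
      J.card + 1 = Fintype.card V := by
  rw [IsSpanningTree, SimpleGraph.isTree_iff_connected_and_card, connected_iff_cut,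
    edgeSet_fromEdgeSet_of_subset hJ, Nat.card_eq_fintype_card (α := V)]
  simp [hJ]

theorem exists_isSpanningTree [Nonempty V] : ∃ J : Finset (Sym2 V), IsSpanningTree J := by
  classical
  obtain ⟨T, -, hT⟩ := (SimpleGraph.connected_top (V := V)).exists_isTree_le
  refine ⟨T.edgeFinset, ?_, ?_⟩
  · rw [edges]
    exact SimpleGraph.edgeFinset_mono le_top
  · rwa [SimpleGraph.coe_edgeFinset, SimpleGraph.fromEdgeSet_edgeSet]

/-- An edge whose ends are not connected by tree edges in `A` can be exchanged for a tree edge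
outside of `A`. -/
theorem IsSpanningTree.exists_exchange [Nonempty V] {J : Finset (Sym2 V)} (hJ : IsSpanningTree J)
    {A : Set (Sym2 V)} {u v : V} (huv : u ≠ v)
    (h : ¬ (SimpleGraph.fromEdgeSet (↑J ∩ A)).Reachable u v) :
    ∃ f ∈ J, f ∉ A ∧ (s(u, v) ∈ A → IsSpanningTree (insert s(u, v) (J.erase f))) := by
  obtain ⟨p, hp⟩ := (hJ.2.connected.preconnected u v).exists_isPath
  have hpJ : ∀ e ∈ p.edges, e ∈ J := fun e he => by
    have := p.edges_subset_edgeSet he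
    rw [edgeSet_fromEdgeSet_of_subset hJ.1] at this
    exact this
  obtain ⟨f, hfp, hfA⟩ : ∃ f ∈ p.edges, f ∉ A := by
    by_contra! hall
    refine h ⟨p.transfer _ fun e he => ?_⟩
    rw [SimpleGraph.edgeSet_fromEdgeSet]
    refine ⟨⟨hpJ e he, hall e he⟩, ?_⟩
    have := p.edges_subset_edgeSet he
    rw [SimpleGraph.edgeSet_fromEdgeSet] at this
    exact this.2
  refine ⟨f, hpJ f hfp, hfA, fun heA => ?_⟩
  have heJ : s(u, v) ∉ J := fun heJ => h (SimpleGraph.Adj.reachable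
    ((SimpleGraph.fromEdgeSet_adj _).2 ⟨⟨heJ, heA⟩, huv⟩))
  have hsub : insert s(u, v) (J.erase f) ⊆ edges V :=
    Finset.insert_subset (mem_edges.2 huv) ((Finset.erase_subset _ _).trans hJ.1)
  obtain ⟨hcut, hcard⟩ := (isSpanningTree_iff hJ.1).1 hJ
  refine (isSpanningTree_iff hsub).2 ⟨fun S hS hS' => ?_, ?_⟩
  · obtain ⟨g, hg⟩ := hcut S hS hS'
    rw [Finset.mem_inter] at hg
    by_contra hno
    rw [Finset.not_nonempty_iff_eq_empty, Finset.eq_empty_iff_forall_notMem] at hno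
    simp only [Finset.mem_inter, Finset.mem_insert, Finset.mem_erase] at hno
    have hcutf : ∀ e ∈ cut S, e ∈ J → e = f := fun e he heJ => by
      by_contra hne
      exact hno e ⟨he, Or.inr ⟨hne, heJ⟩⟩
    -- If a cut missed the new edge set, the tree path from `u` to `v` would cross it only in `f`.
    -- Then `u` and `v` lie on different sides, so `s(u, v)` itself is in the cut.
    have hP : cut S ∩ p.edges.toFinset = {f} := by
      ext e
      rw [Finset.mem_inter, List.mem_toFinset, Finset.mem_singleton]
      constructor
      · rintro ⟨h1, h2⟩
        exact hcutf e h1 (hpJ e h2)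
      · rintro rfl
        refine ⟨?_, hfp⟩
        rw [← hcutf g hg.1 hg.2]
        exact hg.1
    have hpar := natCast_card_cut p.edges.toFinset S
    rw [hP, edges_toFinset_val hp, boundary_walk] at hpar
    simp only [Pi.add_apply, Finset.sum_add_distrib, sum_single_one, Finset.card_singleton,
      Nat.cast_one] at hpar
    refine hno s(u, v) ⟨mem_cut.2 ?_, Or.inl rfl⟩
    by_cases hu : u ∈ S <;> by_cases hv : v ∈ S
    · rw [if_pos hu, if_pos hv] at hpar; exact absurd hpar (by decide)
    · exact Or.inl ⟨hu, hv⟩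
    · exact Or.inr ⟨hv, hu⟩
    · rw [if_neg hu, if_neg hv] at hpar; exact absurd hpar (by decide)
  · rw [Finset.card_insert_of_notMem (fun h => heJ (Finset.mem_of_mem_erase h)),
      Finset.card_erase_of_mem (hpJ f hfp)]
    have := Finset.card_pos.2 ⟨f, hpJ f hfp⟩
    omega

theorem component_eq_of_mem {H : Set (Sym2 V)} {u v : V} (h : u ∈ component H v) :
    component H u = component H v := by
  ext w
  rw [mem_component] at h
  rw [mem_component, mem_component]
  exact ⟨h.trans, h.symm.trans⟩

/-- Every vertex of the component other than `v` is assigned an edge to a neighbour closer to `v`.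
No edge is assigned twice, since it would have to decrease the distance in both directions. -/
theorem card_component_le (K : Finset (Sym2 V)) (v : V) :
    (component ↑K v).card ≤ (inside (component ↑K v) ∩ K).card + 1 := by
  set G := SimpleGraph.fromEdgeSet (K : Set (Sym2 V)) with hG
  have key : ∀ w : V, ∃ w' : V, w ∈ (component ↑K v).erase v →
      G.Adj w w' ∧ G.dist w' v < G.dist w v := by
    intro w
    by_cases hw : w ∈ (component ↑K v).erase v
    · rw [Finset.mem_erase, mem_component] at hw
      obtain ⟨p, hp⟩ := hw.2.symm.exists_walk_length_eq_dist
      cases p with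
      | nil => exact absurd rfl hw.1
      | @cons _ w' _ hadj q =>
        rw [SimpleGraph.Walk.length_cons] at hp
        exact ⟨w', fun _ => ⟨hadj, Nat.lt_of_le_of_lt (SimpleGraph.dist_le q) (Nat.lt_of_succ_le hp.le)⟩⟩
    · exact ⟨w, fun h => absurd h hw⟩
  choose g hg using key
  rw [← Finset.card_erase_add_one (self_mem_component (↑K) v)]
  refine Nat.add_le_add_right (Finset.card_le_card_of_injOn (fun w => s(w, g w)) ?_ ?_) 1
  · intro w hw
    have h1 := (hg w hw).1
    rw [hG, SimpleGraph.fromEdgeSet_adj] at h1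
    have hwc := Finset.mem_of_mem_erase hw
    refine Finset.mem_coe.2 (Finset.mem_inter.2 ⟨mem_inside.2 ⟨h1.2, hwc, ?_⟩, h1.1⟩)
    rw [mem_component] at hwc ⊢
    exact hwc.trans (hg w hw).1.reachable
  · intro w hw w' hw' heq
    rcases Sym2.eq_iff.1 heq with h | h
    · exact h.1
    · have h1 := (hg w hw).2
      have h2 := (hg w' hw').2
      rw [h.2] at h1
      rw [← h.1] at h2
      omega

/-- The sum of a vector over `A` is bounded by the size of a set of edges `K` that connects the
ends of all edges of `A`, if the vector satisfies the subtour constraints. -/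
theorem sum_le_card {x : Sym2 V → ℝ} (hx : ∀ e ∈ edges V, 0 ≤ x e)
    (hsub : ∀ S : Finset V, S.Nonempty → ∑ e ∈ inside S, x e ≤ S.card - 1)
    {A K : Finset (Sym2 V)} (hA : A ⊆ edges V)
    (hAK : ∀ u v, s(u, v) ∈ A →
      (SimpleGraph.fromEdgeSet (K : Set (Sym2 V))).Reachable u v) :
    ∑ e ∈ A, x e ≤ K.card := by
  set P := Finset.univ.image (component (K : Set (Sym2 V))) with hP
  have hmemP : ∀ C ∈ P, ∃ v, component (K : Set (Sym2 V)) v = C := fun C hC => by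
    simpa [hP] using hC
  have hdisj : (P : Set (Finset V)).PairwiseDisjoint inside := by
    intro C hC C' hC' hne
    rw [Function.onFun, Finset.disjoint_left]
    intro e he he'
    obtain ⟨v, rfl⟩ := hmemP C hC
    obtain ⟨v', rfl⟩ := hmemP C' hC'
    induction e with
    | _ a b =>
      exact hne ((component_eq_of_mem (mem_inside.1 he).2.1).symm.trans
        (component_eq_of_mem (mem_inside.1 he').2.1))
  have hAP : A ⊆ P.biUnion inside := by
    intro e he
    induction e with
    | _ a b =>
      refine Finset.mem_biUnion.2 ⟨component ↑K a, Finset.mem_image_of_mem _ (Finset.mem_univ a),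
        mem_inside.2 ⟨mem_edges.1 (hA he), self_mem_component _ a, ?_⟩⟩
      exact mem_component.2 (hAK a b he)
  calc ∑ e ∈ A, x e ≤ ∑ e ∈ P.biUnion inside, x e := by
        refine Finset.sum_le_sum_of_subset_of_nonneg hAP fun e he _ => hx e ?_
        obtain ⟨C, -, hC⟩ := Finset.mem_biUnion.1 he
        exact (Finset.mem_filter.1 hC).1
    _ = ∑ C ∈ P, ∑ e ∈ inside C, x e := Finset.sum_biUnion hdisj
    _ ≤ ∑ C ∈ P, ((inside C ∩ K).card : ℝ) := by
        refine Finset.sum_le_sum fun C hC => ?_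
        obtain ⟨v, rfl⟩ := hmemP C hC
        have h1 := hsub _ ⟨v, self_mem_component (↑K) v⟩
        have h2 : ((component ↑K v).card : ℝ) ≤ (inside (component ↑K v) ∩ K).card + 1 := by
          exact_mod_cast card_component_le K v
        linarith
    _ = ((P.biUnion fun C => inside C ∩ K).card : ℝ) := by
        rw [Finset.card_biUnion, Nat.cast_sum]
        intro C hC C' hC' hne
        exact (hdisj hC hC' hne).mono Finset.inter_subset_left Finset.inter_subset_left
    _ ≤ K.card := by
        refine Nat.cast_le.2 (Finset.card_le_card (Finset.biUnion_subset.2 fun C _ => ?_))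
        exact Finset.inter_subset_right

/-- If all upper level sets of `w` have nonnegative `z`-sum, and the total `z`-sum vanishes, then
the `z`-sum weighted by `w` is nonnegative. -/
theorem sum_mul_nonneg_of_level_sets {α : Type*} (E : Finset α) (z : α → ℝ)
    (hz : ∑ e ∈ E, z e = 0) (n : ℕ) (w : α → ℝ) (hn : (E.image w).card = n)
    (h : ∀ θ : ℝ, 0 ≤ ∑ e ∈ E with θ < w e, z e) : 0 ≤ ∑ e ∈ E, w e * z e := by
  classical
  induction n using Nat.strong_induction_on generalizing w with
  | _ n ih =>
    rcases Nat.lt_or_ge 1 (E.image w).card with h1 | h1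
    · obtain ⟨M, hM, hMmax⟩ := (E.image w).exists_max_image id (Finset.card_pos.1 (by omega))
      obtain ⟨m, hm, hmmax⟩ := ((E.image w).erase M).exists_max_image id
        (Finset.card_pos.1 (by rw [Finset.card_erase_of_mem hM]; omega))
      simp only [id_eq] at hMmax hmmax
      rw [Finset.mem_erase] at hm
      have hmM : m < M := lt_of_le_of_ne (hMmax m hm.2) hm.1
      have hval : ∀ e ∈ E, w e = M ∨ w e ≤ m := fun e he => by
        by_cases heM : w e = M
        · exact Or.inl heM
        · exact Or.inr (hmmax _ (Finset.mem_erase.2 ⟨heM, Finset.mem_image_of_mem w he⟩))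
      -- The top value `M` of `w` is cut down to the second largest value `m`; the part removed is a
      -- nonnegative multiple of an upper level set.
      have hw : ∑ e ∈ E, w e * z e = ∑ e ∈ E, min (w e) m * z e
          + (M - m) * ∑ e ∈ E with m < w e, z e := by
        rw [Finset.mul_sum, Finset.sum_filter, ← Finset.sum_add_distrib]
        refine Finset.sum_congr rfl fun e he => ?_
        rcases hval e he with h2 | h2
        · rw [h2, min_eq_right hmM.le, if_pos hmM]; ring
        · rw [min_eq_left h2, if_neg (not_lt.2 h2), add_zero]
      rw [hw]
      refine add_nonneg (ih _ ?_ (fun e => min (w e) m) rfl fun θ => ?_)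
        (mul_nonneg (by linarith) (h m))
      · rw [← hn]
        refine lt_of_le_of_lt (Finset.card_le_card (t := (E.image w).erase M) ?_)
          (Finset.card_erase_lt_of_mem hM)
        intro r hr
        obtain ⟨e, he, rfl⟩ := Finset.mem_image.1 hr
        rcases hval e he with h2 | h2
        · rw [h2, min_eq_right hmM.le]; exact Finset.mem_erase.2 hm
        · rw [min_eq_left h2]
          exact Finset.mem_erase.2 ⟨by linarith [h2, hmM] |> fun (h3 : w e < M) => h3.ne,
            Finset.mem_image_of_mem w he⟩
      · rcases lt_or_ge θ m with h2 | h2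
        · simp only [lt_min_iff, h2, and_true]
          exact h θ
        · simp only [lt_min_iff, not_lt.2 h2, and_false, Finset.filter_false, Finset.sum_empty,
            le_refl]
    · obtain h0 | ⟨e₀, he₀⟩ := E.eq_empty_or_nonempty
      · simp [h0]
      · have hconst : ∀ e ∈ E, w e * z e = w e₀ * z e := fun e he => by
          rw [Finset.card_le_one.1 h1 _ (Finset.mem_image_of_mem w he) _
            (Finset.mem_image_of_mem w he₀)]
        rw [Finset.sum_congr rfl hconst, ← Finset.mul_sum, hz, mul_zero]

/-- The incidence vector of a set of edges. -/
def incidence (J : Finset (Sym2 V)) : Sym2 V → ℝ := fun e => if e ∈ J then 1 else 0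

/-- A separating functional has edge weights `w`. For a tree `J` of maximum weight, every upper
level set of `w` contains at least as much of `J` as of `x`, and the totals agree. Summing over
levels gives `w(J) ≥ w(x)`, against separation. -/
theorem mem_convexHull_spanningTrees [Nonempty V] {x : Sym2 V → ℝ}
    (hx : ∀ e ∈ edges V, 0 ≤ x e) (hx0 : ∀ e ∉ edges V, x e = 0)
    (hsub : ∀ S : Finset V, S.Nonempty → ∑ e ∈ inside S, x e ≤ S.card - 1)
    (htotal : ∑ e ∈ edges V, x e = Fintype.card V - 1) :
    x ∈ convexHull ℝ (incidence '' {J : Finset (Sym2 V) | IsSpanningTree J}) := by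
  classical
  by_contra hnot
  have hclosed : IsClosed (convexHull ℝ (incidence '' {J : Finset (Sym2 V) | IsSpanningTree J})) :=
    ((Set.toFinite _).isCompact_convexHull (𝕜 := ℝ)).isClosed
  obtain ⟨f, r, hf, hfx⟩ := geometric_hahn_banach_closed_point (convex_convexHull ℝ _) hclosed hnot
  set w : Sym2 V → ℝ := fun e => f (Pi.single e 1) with hw
  have hfy : ∀ y : Sym2 V → ℝ, (∀ e ∉ edges V, y e = 0) → f y = ∑ e ∈ edges V, w e * y e := by
    intro y hy
    have h1 := LinearMap.pi_apply_eq_sum_univ f.toLinearMap y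
    have h2 : ∀ e : Sym2 V, (fun j => if e = j then (1 : ℝ) else 0) = Pi.single e 1 := fun e => by
      ext j
      simp [Pi.single_apply, eq_comm]
    simp only [h2, smul_eq_mul] at h1
    refine (h1.trans ?_ : f y = _)
    rw [← Finset.sum_subset (Finset.subset_univ (edges V))]
    · exact Finset.sum_congr rfl fun e _ => mul_comm _ _
    · intro e _ he
      rw [hy e he, zero_mul]
  obtain ⟨J₀, hJ₀⟩ := exists_isSpanningTree (V := V)
  obtain ⟨J, hJ, hmax⟩ := Finset.exists_max_image
    (Finset.univ.filter fun J : Finset (Sym2 V) => IsSpanningTree J) (fun J => ∑ e ∈ J, w e)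
    ⟨J₀, by simpa using hJ₀⟩
  simp only [Finset.mem_filter, Finset.mem_univ, true_and] at hJ hmax
  -- By maximality, the tree edges heavier than `θ` connect the ends of every edge heavier than `θ`;
  -- otherwise such an edge could replace a tree edge of weight at most `θ`.
  have hlevel : ∀ θ : ℝ, ∑ e ∈ edges V with θ < w e, x e
      ≤ (J ∩ (edges V).filter fun e => θ < w e).card := by
    intro θ
    refine sum_le_card hx hsub (Finset.filter_subset _ _) fun u v huv => ?_
    by_contra hreach
    rw [Finset.mem_filter] at huv
    rw [Finset.coe_inter] at hreach
    obtain ⟨g, hgJ, hgA, htree⟩ := hJ.exists_exchange (mem_edges.1 huv.1) hreach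
    have hAmem : s(u, v) ∈ (edges V).filter fun e => θ < w e := Finset.mem_filter.2 huv
    have heJ : s(u, v) ∉ J := fun heJ => hreach (SimpleGraph.Adj.reachable
      ((SimpleGraph.fromEdgeSet_adj _).2 ⟨⟨heJ, hAmem⟩, mem_edges.1 huv.1⟩))
    have h1 := hmax _ (htree hAmem)
    rw [Finset.sum_insert (fun h => heJ (Finset.mem_of_mem_erase h)),
      ← Finset.add_sum_erase J w hgJ] at h1
    have h2 : w g ≤ θ := by
      by_contra hlt
      exact hgA (Finset.mem_coe.2 (Finset.mem_filter.2 ⟨hJ.1 hgJ, not_le.1 hlt⟩))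
    linarith [huv.2]
  have hcard := ((isSpanningTree_iff hJ.1).1 hJ).2
  have hinc : ∀ A : Finset (Sym2 V), ∑ e ∈ A, incidence J e = (J ∩ A).card := fun A => by
    simp [incidence, Finset.inter_comm]
  have hkey := sum_mul_nonneg_of_level_sets (edges V) (fun e => incidence J e - x e) (by
    rw [Finset.sum_sub_distrib, hinc, Finset.inter_eq_left.2 hJ.1, htotal, ← hcard]
    push_cast
    ring) _ w rfl (fun θ => by
      rw [Finset.sum_sub_distrib, hinc]
      linarith [hlevel θ])
  simp only [mul_sub, Finset.sum_sub_distrib] at hkey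
  rw [← hfy x hx0, ← hfy (incidence J) fun e he => if_neg fun h => he (hJ.1 h)] at hkey
  linarith [hf _ (subset_convexHull ℝ _ (Set.mem_image_of_mem incidence hJ))]

/-! ### Decomposing feasible points into trees -/

theorem sum_degrees {s t : V} (hst : s ≠ t) {x : Sym2 V → ℝ} (hx : IsFeasible s t x)
    (S : Finset V) : ∑ v ∈ S, ∑ e ∈ cut {v}, x e = 2 * S.card - (S ∩ {s, t}).card := by
  have h1 : ∀ v, ∑ e ∈ cut {v}, x e = 2 - (if s = v then 1 else 0) - if t = v then 1 else 0 := by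
    intro v
    by_cases hs : s = v
    · subst hs
      rw [hx.deg_s, if_pos rfl, if_neg hst.symm]; norm_num
    · by_cases ht : t = v
      · subst ht
        rw [hx.deg_t, if_pos rfl, if_neg hs]; norm_num
      · rw [hx.deg_other v (Ne.symm hs) (Ne.symm ht), if_neg hs, if_neg ht]; norm_num
  rw [Finset.sum_congr rfl fun v _ => h1 v, Finset.sum_sub_distrib, Finset.sum_sub_distrib,
    Finset.sum_const, Finset.sum_ite_eq, Finset.sum_ite_eq, card_inter_pair hst]
  push_cast
  rw [nsmul_eq_mul]
  ring

/-- The degrees in `S` sum to `2|S| - |S ∩ {s, t}|`, and `x(δ(S))` is at least 2 or 1 for proper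
`S`, so twice the inner sum is at most `2|S| - 2`. For `S = V` the cut is empty but both `s` and `t`
count. -/
theorem IsFeasible.sum_inside_le {s t : V} (hst : s ≠ t) {x : Sym2 V → ℝ} (hx : IsFeasible s t x)
    {S : Finset V} (hS : S.Nonempty) : ∑ e ∈ inside S, x e ≤ S.card - 1 := by
  have h1 := sum_sum_cut_singleton S x
  rw [sum_degrees hst hx] at h1
  by_cases huniv : S = Finset.univ
  · have h2 : S ∩ {s, t} = {s, t} := by rw [huniv, Finset.univ_inter]
    have h3 : ∑ e ∈ cut S, x e = 0 := by rw [huniv, cut_univ, Finset.sum_empty]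
    rw [h2, Finset.card_pair hst, h3] at h1
    push_cast at h1
    linarith
  · by_cases hodd : (S ∩ {s, t}).card = 1
    · have := hx.odd_cut S hS huniv hodd
      rw [hodd] at h1
      push_cast at h1
      linarith
    · have h2 := card_inter_pair hst S
      have heven : Even (S ∩ {s, t}).card := by
        split_ifs at h2
        · rw [h2]; decide
        · omega
        · omega
        · rw [h2]; decide
      have := hx.even_cut S hS huniv heven
      have h3 : (0 : ℝ) ≤ (S ∩ {s, t}).card := Nat.cast_nonneg _
      linarith

theorem IsFeasible.exists_isTreeDecomposition {s t : V} (hst : s ≠ t) {x : Sym2 V → ℝ}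
    (hx : IsFeasible s t x) : ∃ (l : ℕ) (lam : Fin l → ℝ) (J : Fin l → Finset (Sym2 V)),
      IsTreeDecomposition x lam J := by
  have : Nonempty V := ⟨s⟩
  classical
  set y : Sym2 V → ℝ := fun e => if e ∈ edges V then x e else 0 with hy
  have hxy : ∀ e ∈ edges V, x e = y e := fun e he => (if_pos he).symm
  have hyf := hx.congr hxy
  have htotal : ∑ e ∈ edges V, y e = Fintype.card V - 1 := by
    have h1 := sum_sum_cut_singleton Finset.univ y
    rw [sum_degrees hst hyf, cut_univ, inside_univ, Finset.univ_inter, Finset.card_pair hst,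
      Finset.card_univ, Finset.sum_empty] at h1
    push_cast at h1
    linarith
  obtain ⟨ι, _, w, z, hw, hw1, hz, hsum⟩ := mem_convexHull_iff_exists_fintype.1
    (mem_convexHull_spanningTrees hyf.nonneg (fun e he => if_neg he)
      (fun S hS => hyf.sum_inside_le hst hS) htotal)
  choose J hJ hJz using hz
  -- Trees of coefficient 0 are dropped, as a decomposition requires positive coefficients.
  set κ := {i // 0 < w i}
  have hsub : ∀ g : ι → ℝ, ∑ k : κ, w k * g k = ∑ i, w i * g i := by
    intro g
    rw [← Finset.sum_subtype (Finset.univ.filter fun i => 0 < w i) (by simp) fun i => w i * g i]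
    refine Finset.sum_subset (Finset.subset_univ _) fun i _ hi => ?_
    have : w i = 0 := le_antisymm (not_lt.1 (by simpa using hi)) (hw i)
    rw [this, zero_mul]
  have e := (Fintype.equivFin κ).symm
  refine ⟨Fintype.card κ, fun i => w (e i), fun i => J (e i), fun i => (e i).2, ?_,
    fun i => hJ _, fun f hf => ?_⟩
  · rw [Equiv.sum_comp e fun k : κ => w k, ← hw1]
    simpa using hsub 1
  · rw [Equiv.sum_comp e fun k : κ => w k * (if f ∈ J k then (1 : ℝ) else 0),
      hsub fun i => if f ∈ J i then 1 else 0, hxy f hf, ← hsum, Finset.sum_apply]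
    refine Finset.sum_congr rfl fun i _ => ?_
    rw [Pi.smul_apply, ← hJz, smul_eq_mul]
    rfl

/-! ### Wrong degree vertices and paths in trees -/

theorem isTJoin_wrongVertices_iff {s t : V} (hst : s ≠ t) (J F : Finset (Sym2 V)) :
    IsTJoin (wrongVertices s t J) F ↔
      F ⊆ edges V ∧ boundary F.val = boundary J.val + Pi.single s 1 + Pi.single t 1 := by
  rw [IsTJoin, and_congr_right_iff, funext_iff]
  intro _
  refine forall_congr' fun v => ?_
  simp only [wrongVertices, Finset.mem_filter, Finset.mem_univ, true_and, odd_deg_iff,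
    even_deg_iff, Pi.add_apply]
  have h0 : ∀ a b : ZMod 2, (a = 1 ↔ b = 0) ↔ a = b + 1 + 0 := by decide
  have h1 : ∀ a b : ZMod 2, (a = 1 ↔ b = 0) ↔ a = b + 0 + 1 := by decide
  have h2 : ∀ a b : ZMod 2, (a = 1 ↔ b = 1) ↔ a = b + 0 + 0 := by decide
  by_cases hs : v = s
  · subst hs
    rw [if_pos (Or.inl rfl), Pi.single_eq_same, Pi.single_eq_of_ne hst]
    exact h0 _ _
  · by_cases ht : v = t
    · subst ht
      rw [if_pos (Or.inr rfl), Pi.single_eq_same, Pi.single_eq_of_ne hs]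
      exact h1 _ _
    · rw [if_neg (by tauto), Pi.single_eq_of_ne hs, Pi.single_eq_of_ne ht]
      exact h2 _ _

theorem IsSpanningTree.exists_path {J : Finset (Sym2 V)} (hJ : IsSpanningTree J) (u v : V) :
    ∃ I ⊆ J, boundary I.val = (Pi.single u 1 + Pi.single v 1 : V → ZMod 2) := by
  obtain ⟨I, hIJ, -, hI⟩ := exists_path_of_reachable (hJ.2.connected.preconnected u v)
  exact ⟨I, Finset.coe_subset.1 hIJ, hI⟩

theorem boundary_sdiff {I J : Finset (Sym2 V)} (h : I ⊆ J) :
    boundary (J \ I).val = boundary J.val + boundary I.val := by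
  rw [← symmDiff_of_ge h, boundary_symmDiff]

theorem card_cut_pos_of_sum_boundary {K : Finset (Sym2 V)} {S : Finset V}
    (h : ∑ v ∈ S, boundary K.val v = 1) : 1 ≤ (cut S ∩ K).card := by
  rw [← natCast_card_cut, ZMod.natCast_eq_one_iff_odd] at h
  exact h.pos

/-- A cut that meets a spanning tree in one edge is determined by this edge. -/
theorem IsSpanningTree.eq_of_cut_inter_eq {J : Finset (Sym2 V)} (hJ : IsSpanningTree J) {s : V}
    {S S' : Finset V} (hS : s ∈ S) (hS' : s ∈ S') (h : cut S ∩ J = cut S' ∩ J) : S = S' := by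
  ext v
  obtain ⟨P, hPJ, hP⟩ := hJ.exists_path s v
  have h1 := natCast_card_cut P S
  have h2 := natCast_card_cut P S'
  have h3 : cut S ∩ P = cut S' ∩ P := by
    rw [← Finset.inter_eq_right.2 hPJ, ← Finset.inter_assoc, h, Finset.inter_assoc]
  rw [h3, h2, hP] at h1
  simp only [Pi.add_apply, Finset.sum_add_distrib, sum_single_one, hS, hS', if_true] at h1
  by_cases hv : v ∈ S <;> by_cases hv' : v ∈ S' <;> simp_all

/-! ### The correction vector and the bound on the join -/

/-- The sets that contain `s` but not `t`. -/
def separating (s t : V) : Finset (Finset V) := Finset.univ.filter fun S => s ∈ S ∧ t ∉ S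

theorem mem_separating {s t : V} {S : Finset V} : S ∈ separating s t ↔ s ∈ S ∧ t ∉ S := by
  simp [separating]

/-- The probability that the sampled tree has exactly one edge in `cut S`. -/
def singleProb {l : ℕ} (lam : Fin l → ℝ) (J : Fin l → Finset (Sym2 V)) (S : Finset V) : ℝ :=
  ∑ i, if (cut S ∩ J i).card = 1 then lam i else 0

/-- The vector that distributes `singleProb lam J S` to the edges by which `cut S` meets the
trees having one edge in it. -/
def singleVector {l : ℕ} (lam : Fin l → ℝ) (J : Fin l → Finset (Sym2 V)) (S : Finset V)
    (e : Sym2 V) : ℝ :=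
  ∑ i, if (cut S ∩ J i).card = 1 ∧ e ∈ cut S ∩ J i then lam i else 0

/-- The vector in the dominant of the polytope of `T`-joins, for `T` the set of wrong degree
vertices of `J i`, by which the cost of a cheapest join is estimated. -/
noncomputable def parityVector {l : ℕ} (s t : V) (x : Sym2 V → ℝ) (lam : Fin l → ℝ)
    (J I : Fin l → Finset (Sym2 V)) (α : Finset V → ℝ) (i : Fin l) (e : Sym2 V) : ℝ :=
  2 / 5 * x e + 1 / 5 * (if e ∈ J i then 1 else 0) - 1 / 10 * (if e ∈ I i then 1 else 0) +
    ∑ S ∈ separating s t, if (cut S ∩ J i).card = 1 then 0 else α S * singleVector lam J S e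

variable {l : ℕ} {s t : V} {x : Sym2 V → ℝ} {lam : Fin l → ℝ} {J I : Fin l → Finset (Sym2 V)}

theorem singleVector_nonneg (hlam : ∀ i, 0 < lam i) (S : Finset V) (e : Sym2 V) :
    0 ≤ singleVector lam J S e :=
  Finset.sum_nonneg fun i _ => by
    split_ifs
    · exact (hlam i).le
    · exact le_rfl

theorem sum_singleVector (lam : Fin l → ℝ) (J : Fin l → Finset (Sym2 V)) (S : Finset V) :
    ∑ e ∈ cut S, singleVector lam J S e = singleProb lam J S := by
  simp_rw [singleVector]
  rw [Finset.sum_comm]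
  refine Finset.sum_congr rfl fun i _ => ?_
  by_cases h : (cut S ∩ J i).card = 1
  · simp only [h, true_and, if_true]
    rw [Finset.sum_ite_mem, ← Finset.inter_assoc, Finset.inter_self, Finset.sum_const, h, one_smul]
  · simp [h]

theorem sum_incidence (D K : Finset (Sym2 V)) :
    ∑ e ∈ D, (if e ∈ K then (1 : ℝ) else 0) = (D ∩ K).card := by
  rw [Finset.sum_boole, Finset.filter_mem_eq_inter]

/-- The cut value is the expected number of tree edges in the cut, which is 1 with probability
`singleProb` and at least 2 otherwise. -/
theorem two_sub_singleProb_le (hx : IsTreeDecomposition x lam J) {S : Finset V}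
    (hS : S.Nonempty) (hS' : S ≠ Finset.univ) :
    2 - singleProb lam J S ≤ ∑ e ∈ cut S, x e := by
  have h1 : ∑ e ∈ cut S, x e = ∑ i, lam i * (cut S ∩ J i).card := by
    rw [Finset.sum_congr rfl fun e he => (hx.sum_eq e (cut_subset_edges S he)).symm,
      Finset.sum_comm]
    exact Finset.sum_congr rfl fun i _ => by rw [← Finset.mul_sum, sum_incidence]
  have h2 : (2 : ℝ) = ∑ i, lam i * 2 := by rw [← Finset.sum_mul, hx.sum_eq_one, one_mul]
  rw [h1, h2, singleProb, ← Finset.sum_sub_distrib]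
  refine Finset.sum_le_sum fun i _ => ?_
  have : Nonempty V := hS.to_type
  have h3 : 1 ≤ (cut S ∩ J i).card :=
    Finset.card_pos.2 (((isSpanningTree_iff (hx.tree i).1).1 (hx.tree i)).1 S hS hS')
  split_ifs with h
  · rw [h]; push_cast; linarith
  · have h4 : (2 : ℝ) ≤ (cut S ∩ J i).card := by exact_mod_cast (by omega)
    have := mul_le_mul_of_nonneg_left h4 (hx.pos i).le
    linarith

/-- For fixed `i` and `e`, at most one separating set has `e` as its only edge of `J i`. If there is
one, the path `I i ⊆ J i` has to cross its cut in `e`. -/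
theorem sum_singleVector_le (hx : IsTreeDecomposition x lam J)
    (hI : ∀ i, boundary (I i).val = (Pi.single s 1 + Pi.single t 1 : V → ZMod 2))
    (hIJ : ∀ i, I i ⊆ J i) (e : Sym2 V) :
    ∑ S ∈ separating s t, singleVector lam J S e ≤ ∑ i, lam i * (if e ∈ I i then 1 else 0) := by
  simp_rw [singleVector]
  rw [Finset.sum_comm]
  refine Finset.sum_le_sum fun i _ => ?_
  rw [← Finset.sum_filter, Finset.sum_const, nsmul_eq_mul, mul_comm]
  refine mul_le_mul_of_nonneg_left ?_ (hx.pos i).le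
  have key : ∀ S ∈ (separating s t).filter
      (fun S => (cut S ∩ J i).card = 1 ∧ e ∈ cut S ∩ J i), s ∈ S ∧ t ∉ S ∧ cut S ∩ J i = {e} := by
    intro S hS
    rw [Finset.mem_filter, mem_separating] at hS
    obtain ⟨f, hf⟩ := Finset.card_eq_one.1 hS.2.1
    have h1 := hS.2.2
    rw [hf, Finset.mem_singleton] at h1
    exact ⟨hS.1.1, hS.1.2, by rw [hf, h1]⟩
  split_ifs with he
  · refine Nat.cast_le_one.2 (Finset.card_le_one.2 fun S hS S' hS' => ?_)
    have h1 := key S hS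
    have h2 := key S' hS'
    exact (hx.tree i).eq_of_cut_inter_eq h1.1 h2.1 (h1.2.2.trans h2.2.2.symm)
  · rw [Finset.card_eq_zero.2 (Finset.filter_eq_empty_iff.2 fun S hS hSi => he ?_), Nat.cast_zero]
    have h1 := key S (Finset.mem_filter.2 ⟨hS, hSi⟩)
    have h2 := card_cut_pos_of_sum_boundary (K := I i) (S := S) (by
      rw [hI i]
      simp only [Pi.add_apply, Finset.sum_add_distrib, sum_single_one, h1.1, h1.2.1, if_true,
        if_false, add_zero])
    obtain ⟨f, hf⟩ := Finset.card_pos.1 h2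
    rw [Finset.mem_inter] at hf
    have h3 : f ∈ cut S ∩ J i := Finset.mem_inter.2 ⟨hf.1, hIJ i hf.2⟩
    rw [h1.2.2, Finset.mem_singleton] at h3
    rw [← h3]
    exact hf.2

/-- Nothing is missing for `σ ≤ 1/4`. Otherwise the smallest `α` covering the deficit is `2/5 -
1/(10σ)`, and the upper bound becomes `(2σ - 1)² ≥ 0`, tight at `σ = 1/2`. -/
theorem exists_coefficient (σ : ℝ) :
    ∃ α : ℝ, 0 ≤ α ∧ (1 - σ) * α ≤ 1 / 10 ∧ 2 / 5 * σ - 1 / 10 ≤ α * σ := by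
  rcases le_or_gt σ (1 / 4) with h | h
  · exact ⟨0, le_rfl, by norm_num, by linarith⟩
  · have hσ : 0 < σ := by linarith
    refine ⟨(4 * σ - 1) / (10 * σ), by apply div_nonneg <;> linarith, ?_, ?_⟩
    · rw [← mul_div_assoc, div_le_iff₀ (by linarith)]
      nlinarith [sq_nonneg (2 * σ - 1)]
    · have : (4 * σ - 1) / (10 * σ) * σ = 2 / 5 * σ - 1 / 10 := by
        field_simp
        ring
      exact this.ge

theorem parityVector_nonneg (hxf : IsFeasible s t x) (hx : IsTreeDecomposition x lam J)
    (hIJ : ∀ i, I i ⊆ J i) {α : Finset V → ℝ} (hα : ∀ S, 0 ≤ α S) (i : Fin l) {e : Sym2 V}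
    (he : e ∈ edges V) : 0 ≤ parityVector s t x lam J I α i e := by
  have h1 := hxf.nonneg e he
  have h2 : (if e ∈ I i then (1 : ℝ) else 0) ≤ if e ∈ J i then 1 else 0 := by
    by_cases h : e ∈ I i
    · rw [if_pos h, if_pos (hIJ i h)]
    · rw [if_neg h]; split_ifs <;> norm_num
  have h3 : (0 : ℝ) ≤ if e ∈ J i then 1 else 0 := by split_ifs <;> norm_num
  have h4 : 0 ≤ ∑ S ∈ separating s t,
      if (cut S ∩ J i).card = 1 then 0 else α S * singleVector lam J S e :=
    Finset.sum_nonneg fun S _ => by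
      split_ifs
      · exact le_rfl
      · exact mul_nonneg (hα S) (singleVector_nonneg hx.pos S e)
  rw [parityVector]
  linarith

theorem sum_parityVector (D : Finset (Sym2 V)) (α : Finset V → ℝ) (i : Fin l) :
    ∑ e ∈ D, parityVector s t x lam J I α i e =
      2 / 5 * ∑ e ∈ D, x e + 1 / 5 * (D ∩ J i).card - 1 / 10 * (D ∩ I i).card +
        ∑ S ∈ separating s t,
          if (cut S ∩ J i).card = 1 then 0 else α S * ∑ e ∈ D, singleVector lam J S e := by
  simp only [parityVector]
  rw [Finset.sum_add_distrib, Finset.sum_sub_distrib, Finset.sum_add_distrib, ← Finset.mul_sum,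
    ← Finset.mul_sum, ← Finset.mul_sum, sum_incidence, sum_incidence, Finset.sum_comm]
  congr 1
  refine Finset.sum_congr rfl fun S _ => ?_
  split_ifs
  · simp
  · rw [Finset.mul_sum]

theorem one_le_sum_cut_parityVector (hst : s ≠ t) (hxf : IsFeasible s t x)
    (hx : IsTreeDecomposition x lam J)
    (hI : ∀ i, boundary (I i).val = (Pi.single s 1 + Pi.single t 1 : V → ZMod 2))
    (hIJ : ∀ i, I i ⊆ J i) {α : Finset V → ℝ} (hα : ∀ S, 0 ≤ α S)
    (hασ : ∀ S, 2 / 5 * singleProb lam J S - 1 / 10 ≤ α S * singleProb lam J S) (i : Fin l)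
    {S : Finset V} (hS : ∑ v ∈ S, boundary (J i \ I i).val v = 1) :
    1 ≤ ∑ e ∈ cut S, parityVector s t x lam J I α i e := by
  have hterm : ∀ S', 0 ≤ if (cut S' ∩ J i).card = 1 then 0 else
      α S' * ∑ e ∈ cut S, singleVector lam J S' e := fun S' => by
    split_ifs
    · exact le_rfl
    · exact mul_nonneg (hα S') (Finset.sum_nonneg fun e _ => singleVector_nonneg hx.pos S' e)
  rw [sum_parityVector]
  have hA := card_cut_pos_of_sum_boundary hS
  have hne : (cut S).Nonempty := (Finset.card_pos.1 hA).mono Finset.inter_subset_left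
  have hSne : S.Nonempty := by
    by_contra h
    rw [Finset.not_nonempty_iff_eq_empty.1 h] at hS
    simp at hS
  have hSuniv : S ≠ Finset.univ := by
    rintro rfl
    rw [cut_univ] at hne
    exact Finset.not_nonempty_empty hne
  have hJ : (cut S ∩ J i).card = (cut S ∩ (J i \ I i)).card + (cut S ∩ I i).card := by
    rw [← Finset.card_union_of_disjoint
      (Finset.sdiff_disjoint.mono Finset.inter_subset_right Finset.inter_subset_right),
      ← Finset.inter_union_distrib_left, Finset.sdiff_union_of_subset (hIJ i)]
  have hA' : (1 : ℝ) ≤ (cut S ∩ (J i \ I i)).card := by exact_mod_cast hA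
  have hJ' : ((cut S ∩ J i).card : ℝ) = (cut S ∩ (J i \ I i)).card + (cut S ∩ I i).card := by
    exact_mod_cast hJ
  by_cases hodd : s ∈ S ↔ t ∉ S
  · have hI1 : 1 ≤ (cut S ∩ I i).card := card_cut_pos_of_sum_boundary (by
      rw [hI i]
      simp only [Pi.add_apply, Finset.sum_add_distrib, sum_single_one]
      by_cases hs : s ∈ S
      · rw [if_pos hs, if_neg (hodd.1 hs), add_zero]
      · rw [if_neg hs, if_pos (by tauto), zero_add])
    have hI1' : (1 : ℝ) ≤ (cut S ∩ I i).card := by exact_mod_cast hI1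
    obtain ⟨S', hS', hcut⟩ : ∃ S' ∈ separating s t, cut S' = cut S := by
      by_cases hs : s ∈ S
      · exact ⟨S, mem_separating.2 ⟨hs, hodd.1 hs⟩, rfl⟩
      · refine ⟨Sᶜ, mem_separating.2 ?_, cut_compl S⟩
        simp only [Finset.mem_compl]
        tauto
    -- Of the correction only the term of this very cut is used. It is present because both `I i`
    -- and `J i \ I i` cross the cut, so `J i` has at least two edges in it.
    have h1 := Finset.single_le_sum (f := fun S' => if (cut S' ∩ J i).card = 1 then 0 else
      α S' * ∑ e ∈ cut S, singleVector lam J S' e) (fun S' _ => hterm S') hS'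
    rw [if_neg (by rw [hcut]; omega)] at h1
    have h2 := sum_singleVector lam J S'
    rw [hcut] at h2
    rw [h2] at h1
    have h3 := two_sub_singleProb_le hx hSne hSuniv
    have h4 : singleProb lam J S' = singleProb lam J S := by simp only [singleProb, hcut]
    have h5 := hασ S'
    rw [h4] at h1 h5
    linarith
  · have h1 := hxf.even_cut S hSne hSuniv (by
      rw [card_inter_pair hst]
      by_cases hs : s ∈ S
      · rw [if_pos hs, if_pos (by tauto)]; decide
      · rw [if_neg hs, if_neg (by tauto)]; decide)
    have h2 : 0 ≤ ∑ S' ∈ separating s t, if (cut S' ∩ J i).card = 1 then 0 else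
        α S' * ∑ e ∈ cut S, singleVector lam J S' e := Finset.sum_nonneg fun S' _ => hterm S'
    have h3 : (0 : ℝ) ≤ (cut S ∩ I i).card := Nat.cast_nonneg _
    linarith

theorem expect_parityVector_le (hx : IsTreeDecomposition x lam J)
    (hI : ∀ i, boundary (I i).val = (Pi.single s 1 + Pi.single t 1 : V → ZMod 2))
    (hIJ : ∀ i, I i ⊆ J i) {α : Finset V → ℝ}
    (hασ : ∀ S, (1 - singleProb lam J S) * α S ≤ 1 / 10) {e : Sym2 V} (he : e ∈ edges V) :
    ∑ i, lam i * parityVector s t x lam J I α i e ≤ 3 / 5 * x e := by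
  -- `singleVector` does not depend on the sampled tree, so each correction is just multiplied by
  -- the probability `1 - singleProb` of being used.
  have hcorr : ∑ i, lam i * ∑ S ∈ separating s t,
      (if (cut S ∩ J i).card = 1 then 0 else α S * singleVector lam J S e) =
      ∑ S ∈ separating s t, (1 - singleProb lam J S) * α S * singleVector lam J S e := by
    simp_rw [Finset.mul_sum]
    rw [Finset.sum_comm]
    refine Finset.sum_congr rfl fun S _ => ?_
    rw [← hx.sum_eq_one, singleProb, ← Finset.sum_sub_distrib, mul_assoc, Finset.sum_mul]
    refine Finset.sum_congr rfl fun i _ => ?_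
    split_ifs <;> ring
  have hle : ∑ S ∈ separating s t, (1 - singleProb lam J S) * α S * singleVector lam J S e ≤
      1 / 10 * ∑ i, lam i * (if e ∈ I i then 1 else 0) := by
    refine le_trans ?_ (mul_le_mul_of_nonneg_left (sum_singleVector_le hx hI hIJ e) (by norm_num))
    rw [Finset.mul_sum]
    exact Finset.sum_le_sum fun S _ =>
      mul_le_mul_of_nonneg_right (hασ S) (singleVector_nonneg hx.pos S e)
  have hsplit : ∑ i, lam i * parityVector s t x lam J I α i e =
      2 / 5 * x e * ∑ i, lam i + 1 / 5 * ∑ i, lam i * (if e ∈ J i then 1 else 0) -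
        1 / 10 * ∑ i, lam i * (if e ∈ I i then 1 else 0) +
        ∑ i, lam i * ∑ S ∈ separating s t,
          (if (cut S ∩ J i).card = 1 then 0 else α S * singleVector lam J S e) := by
    rw [Finset.mul_sum, Finset.mul_sum, Finset.mul_sum, ← Finset.sum_add_distrib,
      ← Finset.sum_sub_distrib, ← Finset.sum_add_distrib]
    refine Finset.sum_congr rfl fun i _ => ?_
    rw [parityVector]
    ring
  rw [hsplit, hx.sum_eq_one, hx.sum_eq e he, hcorr]
  linarith

/-- The expected cost of the joins is at most `3/5` times the cost of the LP solution. -/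
theorem expect_join_cost_le {c : Sym2 V → ℝ} (hc : IsMetricCost c) (hst : s ≠ t)
    (hxf : IsFeasible s t x) (hx : IsTreeDecomposition x lam J) {F : Fin l → Finset (Sym2 V)}
    (hF : ∀ i, IsMinTJoin c (wrongVertices s t (J i)) (F i)) :
    expect lam (fun i => ∑ e ∈ F i, c e) ≤ 3 / 5 * lpCost c x := by
  choose I hIJ hI using fun i => (hx.tree i).exists_path s t
  choose α hα hα1 hα2 using fun S =>
    exists_coefficient (singleProb lam J S)
  have hcost : ∀ i, ∑ e ∈ F i, c e ≤
      ∑ e ∈ edges V, c e * parityVector s t x lam J I α i e := by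
    intro i
    have h1 := hF i
    simp only [IsMinTJoin, isTJoin_wrongVertices_iff hst] at h1
    refine join_cost_le hc.nonneg h1.1.1 h1.1.2 (fun G hG hGb => h1.2 G ⟨hG, hGb⟩)
      (fun e he => parityVector_nonneg hxf hx hIJ hα i he) fun S hS => ?_
    refine one_le_sum_cut_parityVector hst hxf hx hI hIJ hα hα2 i ?_
    rwa [boundary_sdiff (hIJ i), hI i, ← add_assoc]
  calc expect lam (fun i => ∑ e ∈ F i, c e)
      ≤ ∑ i, lam i * ∑ e ∈ edges V, c e * parityVector s t x lam J I α i e :=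
        Finset.sum_le_sum fun i _ => mul_le_mul_of_nonneg_left (hcost i) (hx.pos i).le
    _ = ∑ e ∈ edges V, c e * ∑ i, lam i * parityVector s t x lam J I α i e := by
        simp_rw [Finset.mul_sum]
        rw [Finset.sum_comm]
        exact Finset.sum_congr rfl fun e _ => Finset.sum_congr rfl fun i _ => by ring
    _ ≤ ∑ e ∈ edges V, c e * (3 / 5 * x e) := Finset.sum_le_sum fun e he =>
        mul_le_mul_of_nonneg_left (expect_parityVector_le hx hI hIJ hα1 he) (hc.nonneg e he)
    _ = 3 / 5 * lpCost c x := by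
        rw [lpCost, Finset.mul_sum]
        exact Finset.sum_congr rfl fun e _ => by ring

theorem expect_tree_cost_eq (hx : IsTreeDecomposition x lam J) (c : Sym2 V → ℝ) :
    expect lam (fun i => ∑ e ∈ J i, c e) = lpCost c x := by
  rw [expect, lpCost, Finset.sum_congr rfl fun e he => congrArg (c e * ·) (hx.sum_eq e he).symm]
  simp_rw [Finset.mul_sum]
  rw [Finset.sum_comm]
  refine Finset.sum_congr rfl fun i _ => ?_
  rw [← Finset.mul_sum, ← Finset.inter_eq_right.2 (hx.tree i).1, ← Finset.sum_ite_mem,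
    Finset.mul_sum]
  refine Finset.sum_congr rfl fun e he => ?_
  rw [Finset.inter_eq_right.2 (hx.tree i).1]
  split_ifs <;> ring

/-! ### Feasibility of the steps of the algorithm -/

theorem exists_isMinTJoin (hst : s ≠ t) (c : Sym2 V → ℝ) {T : Finset (Sym2 V)}
    (hT : IsSpanningTree T) : ∃ F, IsMinTJoin c (wrongVertices s t T) F := by
  classical
  obtain ⟨P, hPT, hP⟩ := hT.exists_path s t
  obtain ⟨F, hF, hmin⟩ := Finset.exists_min_image
    (Finset.univ.filter fun F => IsTJoin (wrongVertices s t T) F) (fun F => ∑ e ∈ F, c e)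
    -- Deleting the `s`-`t` path from the tree leaves a join, so there is something to minimize
    -- over.
    ⟨T \ P, by
      rw [Finset.mem_filter, isTJoin_wrongVertices_iff hst, boundary_sdiff hPT, hP, add_assoc]
      exact ⟨Finset.mem_univ _, Finset.sdiff_subset.trans hT.1, rfl⟩⟩
  exact ⟨F, (Finset.mem_filter.1 hF).2, fun G hG =>
    hmin G (Finset.mem_filter.2 ⟨Finset.mem_univ _, hG⟩)⟩

theorem exists_isEulerianTraversal (hst : s ≠ t) {T F : Finset (Sym2 V)} (hT : IsSpanningTree T)
    (hF : IsTJoin (wrongVertices s t T) F) :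
    ∃ p : (⊤ : SimpleGraph V).Walk s t, IsEulerianTraversal T F p := by
  have : Nonempty V := ⟨s⟩
  rw [isTJoin_wrongVertices_iff hst] at hF
  refine exists_walk_edges_eq (fun e he => ?_) (fun S hS hS' => ?_) ?_
  · exact (Multiset.mem_add.1 he).elim (fun h => hT.1 h) fun h => hF.1 h
  · obtain ⟨e, he⟩ := ((isSpanningTree_iff hT.1).1 hT).1 S hS hS'
    rw [Finset.mem_inter] at he
    exact ⟨e, Multiset.mem_add.2 (Or.inl he.2), he.1⟩
  · rw [boundary_add, hF.2]
    linear_combination boundary T.val * pi_zmod_two (V := V)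

theorem IsEulerianTraversal.exists_isShortcut (hst : s ≠ t) {T F : Finset (Sym2 V)}
    (hT : IsSpanningTree T) {p : (⊤ : SimpleGraph V).Walk s t} (hp : IsEulerianTraversal T F p) :
    ∃ q, IsShortcut p q := by
  have : Nonempty V := ⟨s⟩
  refine STPathTSP.exists_isShortcut hst p fun v => ?_
  obtain ⟨e, he⟩ := ((isSpanningTree_iff hT.1).1 hT).1 {v} (Finset.singleton_nonempty v) fun h =>
    hst ((Finset.mem_singleton.1 (h ▸ Finset.mem_univ s)).trans
      (Finset.mem_singleton.1 (h ▸ Finset.mem_univ t)).symm)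
  rw [Finset.mem_inter] at he
  obtain ⟨u, w, hu, -, rfl⟩ := exists_end_of_mem_cut he.1
  rw [Finset.mem_singleton] at hu
  subst hu
  have hmem : s(u, w) ∈ (p.edges : Multiset (Sym2 V)) := by
    rw [show (p.edges : Multiset (Sym2 V)) = _ from hp]
    exact Multiset.mem_add.2 (Or.inl he.2)
  exact p.fst_mem_support_of_mem_edges hmem

end STPathTSP

/-! ### The approximation guarantee -/

theorem mainTheorem1 {V : Type*} [Fintype V] [DecidableEq V]
    (c : Sym2 V → ℝ) (hc : IsMetricCost c) (s t : V) (hst : s ≠ t) :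
    -- every step of the algorithm can be carried out
    ((∃ x, IsOptimal c s t x) ∧
      (∀ x, IsOptimal c s t x →
        ∃ (l : ℕ) (lam : Fin l → ℝ) (J : Fin l → Finset (Sym2 V)),
          IsTreeDecomposition x lam J) ∧
      (∀ J : Finset (Sym2 V), IsSpanningTree J →
        (∃ F, IsMinTJoin c (wrongVertices s t J) F) ∧
        ∀ F, IsMinTJoin c (wrongVertices s t J) F →
          (∃ p : (⊤ : SimpleGraph V).Walk s t, IsEulerianTraversal J F p) ∧
          ∀ p : (⊤ : SimpleGraph V).Walk s t, IsEulerianTraversal J F p →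
            ∃ q, IsShortcut p q)) ∧
    -- and, whatever choices are made, the expected cost is within 8/5 of the optimum
    (∀ (x : Sym2 V → ℝ) (l : ℕ) (lam : Fin l → ℝ) (J F : Fin l → Finset (Sym2 V))
        (p q : Fin l → (⊤ : SimpleGraph V).Walk s t),
        IsExecution c s t x lam J F p q →
        expect lam (fun i => walkCost c (q i)) ≤
            expect lam (fun i => ∑ e ∈ J i, c e + ∑ e ∈ F i, c e) ∧
          expect lam (fun i => ∑ e ∈ J i, c e + ∑ e ∈ F i, c e) ≤ 8 / 5 * lpCost c x ∧
          ∀ h : (⊤ : SimpleGraph V).Walk s t, h.IsHamiltonian →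
            lpCost c x ≤ walkCost c h ∧
              expect lam (fun i => walkCost c (q i)) ≤ 8 / 5 * walkCost c h) := by
  refine ⟨⟨exists_isOptimal c hst, fun x hx => hx.1.exists_isTreeDecomposition hst,
    fun J hJ => ⟨exists_isMinTJoin hst c hJ, fun F hF =>
      ⟨exists_isEulerianTraversal hst hJ hF.1, fun p hp => hp.exists_isShortcut hst hJ⟩⟩⟩, ?_⟩
  intro x l lam J F p q h
  have hpath : expect lam (fun i => walkCost c (q i)) ≤
      expect lam (fun i => ∑ e ∈ J i, c e + ∑ e ∈ F i, c e) :=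
    Finset.sum_le_sum fun i _ => mul_le_mul_of_nonneg_left
      (((h.shortcut i).walkCost_le hc).trans_eq ((h.traversal i).walkCost_eq c))
      (h.decomposition.pos i).le
  have hjoin : expect lam (fun i => ∑ e ∈ J i, c e + ∑ e ∈ F i, c e) ≤ 8 / 5 * lpCost c x := by
    have h1 := expect_join_cost_le hc hst h.optimal.1 h.decomposition h.join
    have h2 := expect_tree_cost_eq h.decomposition c
    have h3 : expect lam (fun i => ∑ e ∈ J i, c e + ∑ e ∈ F i, c e) =
        expect lam (fun i => ∑ e ∈ J i, c e) + expect lam (fun i => ∑ e ∈ F i, c e) := by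
      simp only [expect, mul_add, Finset.sum_add_distrib]
    linarith
  refine ⟨hpath, hjoin, fun w hw => ?_⟩
  have hopt := h.optimal.2 _ (IsHamiltonian.isFeasible hst hw)
  rw [lpCost_indicator_eq hw] at hopt
  exact ⟨hopt, by linarith⟩
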